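/- Let $(M,g)$ be a connected complete Riemannian manifold (smooth, without boundary) of dimension $n$, let $q$ be a real number with $1\le q\le n-1$, let $A>0$ be a constant and $\sigma\ge 0$ a continuous function on $M$, and suppose that the Sobolev inequality $$\left(\int_M|\phi|^{\frac{qn}{n-q}}\right)^{\frac{n-q}{n}}\le A\int_M\left(|\nabla\phi|^q+\sigma|\phi|^q\right)$$ holds for every $\phi\in C_0^\infty(M)$. Fix $p\in M$, let $r(x)=d(p,x)$, let $B_p(R)$ be the geodesic ball of radius $R$ about $p$ and $\mathrm V_p(R)$ its volume, and put $$\alpha=\limsup_{R\to\infty}\frac{1}{\mathrm V_p(R)}\int_{B_p(R)}\left(r^q\sigma\right)^{\frac{n-1}{q}},\qquad V_\infty=\limsup_{R\to\infty}\frac{\mathrm V_p(R)}{R^n}.$$ If $\alpha<\infty$ and $V_\infty<\infty$, then the number of ends of $M$ is at most a finite constant $\Gamma(n,A,\alpha,V_\infty)$ depending only on $n$, $A$, $\alpha$ and $V_\infty$ (in particular not on $M$, $q$, $\sigma$ or $p$). Here an end of $M$ with respect to a compact set $\Omega\subset M$ is an unbounded connected component of $M\setminus\Omega$, and the number of ends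 of $M$ is the supremum, over all compact $\Omega\subset M$, of the number of ends with respect to $\Omega$ (the same number results if $\Omega$ is required to have smooth boundary). -/

import Mathlib

open MeasureTheory Set Filter Bundle Manifold
open scoped ContDiff ENNReal NNReal Topology

noncomputable section

namespace Riem

/-! ### Riemannian volume and the norm of the gradient

Throughout, `M` is a manifold without boundary modelled on `EuclideanSpace ℝ (Fin n)`, with an
inner product on each tangent space. -/

section Volume

variable (n : ℕ) {M : Type*} [TopologicalSpace M] [ChartedSpace (EuclideanSpace ℝ (Fin n)) M]
  [RiemannianBundle (fun x : M ↦ TangentSpace (𝓡 n) x)]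

/-- The coordinate vector field `∂ᵢ` of the chart around `x`, at the point of coordinates `y`. -/
def coordVector (x : M) (y : EuclideanSpace ℝ (Fin n)) (i : Fin n) :
    TangentSpace (𝓡 n) ((extChartAt (𝓡 n) x).symm y) :=
  mfderiv 𝓘(ℝ, EuclideanSpace ℝ (Fin n)) (𝓡 n) (extChartAt (𝓡 n) x).symm y
    (EuclideanSpace.single i (1 : ℝ) : EuclideanSpace ℝ (Fin n))

/-- The matrix `gᵢⱼ = ⟨∂ᵢ, ∂ⱼ⟩` of the metric in the chart around `x`, at coordinates `y`. -/
def metricMatrix (x : M) (y : EuclideanSpace ℝ (Fin n)) : Matrix (Fin n) (Fin n) ℝ :=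
  Matrix.of fun i j ↦ inner ℝ (coordVector n x y i) (coordVector n x y j)

variable [MeasurableSpace M]

/-- The Riemannian volume of the domain of the chart around `x`, as a measure on `M`:
the image of the measure `√(det gᵢⱼ) dy¹ ⋯ dyⁿ` on the range of the chart. -/
def chartVolume (x : M) : Measure M :=
  (((volume : Measure (EuclideanSpace ℝ (Fin n))).restrict (extChartAt (𝓡 n) x).target).withDensity
    (fun y ↦ ENNReal.ofReal (√(metricMatrix n x y).det))).map (extChartAt (𝓡 n) x).symm

variable (M) in
/-- The Riemannian volume measure: the smallest measure on `M` that dominates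
`√(det gᵢⱼ) dy¹ ⋯ dyⁿ` on the domain of each chart. Since these local measures agree on
overlaps, it restricts to `√(det gᵢⱼ) dy¹ ⋯ dyⁿ` on the domain of each chart. -/
def riemannianVolume : Measure M := ⨆ x : M, chartVolume n x

end Volume

section Gradient

variable (n : ℕ) {M : Type*} [TopologicalSpace M] [ChartedSpace (EuclideanSpace ℝ (Fin n)) M]
  [RiemannianBundle (fun x : M ↦ TangentSpace (𝓡 n) x)]

/-- The differential `dφₓ : TₓM → ℝ` of a real function. -/
def differential (φ : M → ℝ) (x : M) : TangentSpace (𝓡 n) x →L[ℝ] ℝ :=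
  mfderiv (𝓡 n) 𝓘(ℝ, ℝ) φ x

/-- `|∇φ|(x)`, the norm of the gradient, i.e. the operator norm of the differential
`dφₓ : TₓM → ℝ` with respect to the Riemannian inner product on `TₓM`. -/
def gradNorm (φ : M → ℝ) (x : M) : ℝ := ‖differential n φ x‖

variable [MeasurableSpace M]

/-- The Sobolev inequality
`(∫ |φ|^{qn/(n-q)})^{(n-q)/n} ≤ A ∫ (|∇φ|^q + σ |φ|^q)` for all `φ ∈ C₀^∞(M)`. -/
def SobolevInequality (q A : ℝ) (σ : M → ℝ) : Prop :=
  ∀ φ : M → ℝ, ContMDiff (𝓡 n) 𝓘(ℝ, ℝ) ∞ φ → HasCompactSupport φ →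
    (∫⁻ x, ENNReal.ofReal (|φ x| ^ (q * n / (n - q))) ∂riemannianVolume n M) ^ ((n - q) / n)
      ≤ ENNReal.ofReal A *
        ∫⁻ x, ENNReal.ofReal (gradNorm n φ x ^ q + σ x * |φ x| ^ q) ∂riemannianVolume n M

end Gradient

/-! ### Volume growth, weighted integral of the potential -/

section Growth

variable (n : ℕ) {M : Type*} [MetricSpace M] [ChartedSpace (EuclideanSpace ℝ (Fin n)) M]
  [RiemannianBundle (fun x : M ↦ TangentSpace (𝓡 n) x)] [MeasurableSpace M]

/-- `V_p(R)`, the volume of the geodesic ball of radius `R` around `p`. -/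
def ballVolume (p : M) (R : ℝ) : ℝ≥0∞ := riemannianVolume n M (Metric.ball p R)

/-- `V_∞ = limsup_{R → ∞} V_p(R) / Rⁿ`. -/
def asymptoticVolumeRatio (p : M) : ℝ≥0∞ :=
  limsup (fun R : ℝ ↦ ballVolume n p R / ENNReal.ofReal (R ^ n)) atTop

/-- `α = limsup_{R → ∞} V_p(R)⁻¹ ∫_{B_p(R)} (r^q σ)^{(n-1)/q}`, where `r = d(p, ·)`. -/
def asymptoticPotential (p : M) (q : ℝ) (σ : M → ℝ) : ℝ≥0∞ :=
  limsup (fun R : ℝ ↦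
    (ballVolume n p R)⁻¹ *
      ∫⁻ x in Metric.ball p R,
        ENNReal.ofReal ((dist p x ^ q * σ x) ^ (((n : ℝ) - 1) / q)) ∂riemannianVolume n M) atTop

end Growth

/-! ### Ends -/

section Ends

variable {M : Type*} [MetricSpace M]

/-- The ends of `M` with respect to `Ω`: the unbounded connected components of `M \ Ω`. -/
def endsWithRespectTo (Ω : Set M) : Set (Set M) :=
  {E | (∃ x ∈ Ωᶜ, E = connectedComponentIn Ωᶜ x) ∧ ¬ Bornology.IsBounded E}

variable (M) in
/-- The number of ends of `M`: the supremum, over all compact `Ω ⊆ M` (with smooth boundary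
or not), of the number of unbounded components of `M \ Ω`. -/
def numberOfEnds : ℕ∞ := ⨆ (Ω : Set M) (_ : IsCompact Ω), (endsWithRespectTo Ω).encard

end Ends

end Riem

end

/-!
The number of ends is bounded because each end uses up, at every large scale `R`, a definite share
of the volume and of the weighted potential available in the ball `B_p(3R)`. Write
`s = (n - 1) / q ≥ 1`.

*Volume dichotomy* (`Riem.SobolevInequality.lt_riemannianVolume_ball`). There is `ε = ε(n, A) > 0`
such that, if `∫_{B_x(r)} σ ^ s ≤ ε r` for all `r ≤ R`, then `V_x(R) > ε Rⁿ`. Indeed, the Sobolev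
inequality for a cutoff function between `B_x(r / 2)` and `B_x(r)`, together with Hölder's
inequality for the potential term, turns the bound `V_x(r) ≤ ε rⁿ` into
`V_x(r / 2) ≤ ε (r / 2)ⁿ`. The powers of `r` cancel, and the choice of `ε` only has to beat
`ε ^ (q / n) ≤ ε ^ (1 / n)`, so that it is uniform in `q`. If the conclusion failed, the volume
ratio would be at most `ε` at all scales `R / 2ᵏ`, whereas small balls have at least the
Euclidean volume times `4⁻ⁿ` (`Riem.exists_le_riemannianVolume_ball`).

*Covering argument* (`Riem.SobolevInequality.volume_or_potential_of_end`). An end contains points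
at every distance `t ∈ [R, 2R]` from `p`, and the balls of radius at most `R / 2` around these points
are connected, so they stay in the end. Either one of these balls of radius `R / 2` has volume at
least `ε (R / 2)ⁿ`, or for every `t` there is a radius `ρ` with `∫_B σ ^ s > ε ρ` on the
corresponding ball. In the second case, a Vitali covering of `[R, 2R]` by the intervals
`[t - ρ, t + ρ]` yields disjoint balls whose radii add up to at least `R / 10`, and
`∫ (r ^ q σ) ^ s` over the end is at least a constant times `Rⁿ`. Since distinct ends are disjoint,
summing over them and comparing with the growth of volume and potential bounds their number.

The Riemannian input consists of the compactness of closed balls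
(`Riem.properSpace_of_complete`), and of smooth cutoff functions with gradient at most a universal
constant over `r` (`Riem.exists_cutoff`). The latter come from the mollification of the distance
function in charts in which the metric is comparable to a constant one
(`Riem.exists_adapted_chart`), glued by a partition of unity (`Riem.exists_smoothing`).
-/

namespace Riem

/-! ### Length structure and the Hopf–Rinow theorem -/

section LengthSpace

variable {n : ℕ} {M : Type*} [MetricSpace M] [ChartedSpace (EuclideanSpace ℝ (Fin n)) M]
  [RiemannianBundle (fun x : M ↦ TangentSpace (𝓡 n) x)] [IsRiemannianManifold (𝓡 n) M]

variable (n) in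
/-- Almost minimizing paths: all the intermediate points are almost aligned with the endpoints. -/
lemma exists_path_of_dist_lt [IsManifold (𝓡 n) 1 M] {x y : M} {r : ℝ} (h : dist x y < r) :
    ∃ γ : ℝ → M, Continuous γ ∧ γ 0 = x ∧ γ 1 = y ∧
      ∀ t ∈ Icc (0 : ℝ) 1, dist x (γ t) + dist (γ t) y < r := by
  have hr : 0 < r := dist_nonneg.trans_lt h
  have h' : riemannianEDist (𝓡 n) x y < ENNReal.ofReal r := by
    rw [← IsRiemannianManifold.out, edist_dist]
    exact (ENNReal.ofReal_lt_ofReal_iff hr).2 h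
  obtain ⟨γ, h0, h1, hγ, hL, -, -⟩ :=
    exists_lt_locally_constant_of_riemannianEDist_lt h' zero_lt_one
  refine ⟨γ, hγ.continuous, h0, h1, fun t ht ↦ ?_⟩
  have e1 : edist x (γ t) ≤ pathELength (𝓡 n) γ 0 t := by
    rw [IsRiemannianManifold.out (I := 𝓡 n)]
    exact riemannianEDist_le_pathELength hγ.contMDiffOn h0 rfl ht.1
  have e2 : edist (γ t) y ≤ pathELength (𝓡 n) γ t 1 := by
    rw [IsRiemannianManifold.out (I := 𝓡 n)]
    exact riemannianEDist_le_pathELength hγ.contMDiffOn rfl h1 ht.2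
  have e3 := (add_le_add e1 e2).trans_lt ((pathELength_add ht.1 ht.2).trans_lt hL)
  rw [edist_dist, edist_dist, ← ENNReal.ofReal_add dist_nonneg dist_nonneg] at e3
  exact (ENNReal.ofReal_lt_ofReal_iff hr).1 e3

variable (n) in
lemma isPreconnected_ball [IsManifold (𝓡 n) 1 M] (x : M) (r : ℝ) :
    IsPreconnected (Metric.ball x r) := by
  refine isPreconnected_of_forall x fun y hy ↦ ?_
  obtain ⟨γ, hγ, h0, h1, h⟩ := exists_path_of_dist_lt n (Metric.mem_ball'.1 hy)
  refine ⟨γ '' Icc 0 1, ?_, ⟨0, by simp, h0⟩, ⟨1, by simp, h1⟩,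
    isPreconnected_Icc.image _ hγ.continuousOn⟩
  rintro _ ⟨t, ht, rfl⟩
  exact Metric.mem_ball'.2 (by linarith [h t ht, dist_nonneg (x := γ t) (y := y)])

variable (n) in
/-- Approximate midpoints: `M` is a length space. -/
lemma exists_dist_lt_and_dist_lt [IsManifold (𝓡 n) 1 M] {x y : M} {r s : ℝ} (hr : 0 < r)
    (hs : 0 < s) (h : dist x y < r + s) : ∃ z, dist x z < r ∧ dist z y < s := by
  rcases lt_or_ge (dist x y) r with h' | h'
  · exact ⟨y, h', by simpa⟩
  obtain ⟨L, hL1, hL2⟩ := exists_between h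
  obtain ⟨γ, hγ, h0, h1, hd⟩ := exists_path_of_dist_lt n hL1
  obtain ⟨r', hr1, hr2⟩ := exists_between (show max 0 (L - s) < r by
    rw [max_lt_iff]; constructor <;> linarith)
  rw [max_lt_iff] at hr1
  have hc : ContinuousOn (fun t ↦ dist x (γ t)) (Icc (0 : ℝ) 1) := by fun_prop
  obtain ⟨t, ht, hte⟩ := intermediate_value_Icc zero_le_one hc
    (show r' ∈ Icc (dist x (γ 0)) (dist x (γ 1)) by
      rw [h0, h1, dist_self]; exact ⟨hr1.1.le, by linarith⟩)
  simp only at hte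
  exact ⟨γ t, by linarith, by linarith [hd t ht, hr1.2]⟩

variable (n M) in
/-- The **Hopf–Rinow theorem**: closed balls of a complete Riemannian manifold are compact. -/
theorem properSpace_of_complete [IsManifold (𝓡 n) 1 M] [CompleteSpace M] : ProperSpace M := by
  have : LocallyCompactSpace M := ChartedSpace.locallyCompactSpace (EuclideanSpace ℝ (Fin n)) M
  refine ⟨fun x r ↦ ?_⟩
  by_contra hr
  -- The set `S` of radii of compact balls is an initial segment. If it were bounded, its supremum
  -- `ρ` would belong to it (`hρS`), and so would slightly larger radii (`hmem`).
  set S : Set ℝ := {r | IsCompact (Metric.closedBall x r)} with hS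
  have hdown : ∀ {a b : ℝ}, a ≤ b → b ∈ S → a ∈ S := fun hab hb ↦
    IsCompact.of_isClosed_subset hb Metric.isClosed_closedBall
      (Metric.closedBall_subset_closedBall hab)
  have hbdd : BddAbove S := ⟨r, fun s hs ↦ by
    by_contra h
    exact hr (hdown (not_le.1 h).le hs)⟩
  have h0 : (0 : ℝ) ∈ S := by simp [hS]
  have hne : S.Nonempty := ⟨0, h0⟩
  set ρ := sSup S with hρ
  have hlt : ∀ a < ρ, a ∈ S := fun a ha ↦ by
    obtain ⟨b, hb, hab⟩ := exists_lt_of_lt_csSup hne ha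
    exact hdown hab.le hb
  have hρS : ρ ∈ S := by
    refine TotallyBounded.isCompact_of_isClosed ?_ Metric.isClosed_closedBall
    rw [Metric.totallyBounded_iff]
    intro ε hε
    rcases le_or_gt ρ (ε / 4) with hs | hs
    · refine ⟨{x}, finite_singleton x, ?_⟩
      simp only [mem_singleton_iff, iUnion_iUnion_eq_left]
      exact Metric.closedBall_subset_ball (by linarith)
    -- A finite `ε / 2`-net of the compact ball of radius `ρ - ε / 4` is an `ε`-net of the ball of
    -- radius `ρ`, by approximate midpoints.
    have hc := hlt (ρ - ε / 4) (by linarith)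
    obtain ⟨t, htf, ht⟩ := Metric.totallyBounded_iff.1 (show IsCompact _ from hc).totallyBounded
      (ε / 2) (by linarith)
    refine ⟨t, htf, fun y hy ↦ ?_⟩
    obtain ⟨z, hz1, hz2⟩ := exists_dist_lt_and_dist_lt n (x := x) (y := y) (r := ρ - ε / 4)
      (s := ε / 2) (by linarith) (by linarith)
      (by have := Metric.mem_closedBall'.1 hy; linarith)
    have hz := ht (Metric.mem_closedBall'.2 hz1.le)
    simp only [mem_iUnion] at hz ⊢
    obtain ⟨w, hw, hzw⟩ := hz
    refine ⟨w, hw, ?_⟩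
    rw [Metric.mem_ball] at hzw ⊢
    linarith [dist_triangle y z w, dist_comm z y]
  obtain ⟨ε, hε, hc⟩ := (show IsCompact _ from hρS).exists_isCompact_cthickening
  have hmem : ρ + ε / 2 ∈ S := by
    refine IsCompact.of_isClosed_subset hc Metric.isClosed_closedBall fun y hy ↦ ?_
    have hρ0 : 0 ≤ ρ := le_csSup hbdd h0
    obtain ⟨z, hz1, hz2⟩ : ∃ z, dist x z ≤ ρ ∧ dist z y ≤ ε := by
      rcases hρ0.eq_or_lt with h | h
      · refine ⟨x, by simpa using hρ0, ?_⟩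
        have := Metric.mem_closedBall'.1 hy
        linarith
      · obtain ⟨z, hz1, hz2⟩ := exists_dist_lt_and_dist_lt n (x := x) (y := y) h hε
          (by have := Metric.mem_closedBall'.1 hy; linarith)
        exact ⟨z, hz1.le, hz2.le⟩
    exact Metric.mem_cthickening_of_dist_le y z _ _ (Metric.mem_closedBall'.2 hz1)
      (by rwa [dist_comm])
  linarith [le_csSup hbdd hmem]

end LengthSpace

/-! ### The metric in a chart -/

section AdaptedChart

variable {n : ℕ} {M : Type*} [TopologicalSpace M] [ChartedSpace (EuclideanSpace ℝ (Fin n)) M]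
  [RiemannianBundle (fun x : M ↦ TangentSpace (𝓡 n) x)]

variable (n M) in
lemma isContinuousRiemannianBundle [IsManifold (𝓡 n) ∞ M]
    [h : IsContMDiffRiemannianBundle (𝓡 n) ∞ (EuclideanSpace ℝ (Fin n))
      (fun x : M ↦ TangentSpace (𝓡 n) x)] :
    IsContinuousRiemannianBundle (EuclideanSpace ℝ (Fin n))
      (fun x : M ↦ TangentSpace (𝓡 n) x) := by
  obtain ⟨g, hg, h⟩ := h.exists_contMDiff
  exact ⟨g, hg.continuous, h⟩

lemma exists_tangentSpace_isometry (z : M) :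
    Nonempty (TangentSpace (𝓡 n) z ≃ₗᵢ[ℝ] EuclideanSpace ℝ (Fin n)) := by
  have : FiniteDimensional ℝ (TangentSpace (𝓡 n) z) :=
    inferInstanceAs (FiniteDimensional ℝ (EuclideanSpace ℝ (Fin n)))
  have h : Module.finrank ℝ (TangentSpace (𝓡 n) z) = n := by
    have : Module.finrank ℝ (EuclideanSpace ℝ (Fin n)) = n := by simp
    exact this
  exact ⟨((stdOrthonormalBasis ℝ (TangentSpace (𝓡 n) z)).reindex (finCongr h)).repr⟩

variable [IsManifold (𝓡 n) 1 M] [IsContinuousRiemannianBundle (EuclideanSpace ℝ (Fin n))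
      (fun x : M ↦ TangentSpace (𝓡 n) x)]

/-- Close to `z`, the Riemannian metric read in the chart at `z` is equivalent, with the universal
factor `2`, to the constant Euclidean metric `w ↦ ‖A w‖`, where `A` is an isometry from the metric
at `z` to the standard one. -/
lemma exists_adapted_linear_equiv (z : M) :
    ∃ A : EuclideanSpace ℝ (Fin n) ≃L[ℝ] EuclideanSpace ℝ (Fin n),
      (∀ᶠ x in 𝓝 z, ∀ v : TangentSpace (𝓡 n) x,
        ‖A (mfderiv (𝓡 n) 𝓘(ℝ, EuclideanSpace ℝ (Fin n)) (extChartAt (𝓡 n) z) x v)‖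
          ≤ 2 * ‖v‖) ∧
      ∀ᶠ y in 𝓝 (extChartAt (𝓡 n) z z), ∀ w : EuclideanSpace ℝ (Fin n),
        ‖(mfderiv 𝓘(ℝ, EuclideanSpace ℝ (Fin n)) (𝓡 n) (extChartAt (𝓡 n) z).symm y w :
          TangentSpace (𝓡 n) ((extChartAt (𝓡 n) z).symm y))‖ ≤ 2 * ‖A w‖ ∧
        ‖A w‖ ≤ 2 * ‖(mfderiv 𝓘(ℝ, EuclideanSpace ℝ (Fin n)) (𝓡 n) (extChartAt (𝓡 n) z).symm y w :
          TangentSpace (𝓡 n) ((extChartAt (𝓡 n) z).symm y))‖ := by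
  set T := trivializationAt (EuclideanSpace ℝ (Fin n)) (fun x : M ↦ TangentSpace (𝓡 n) x) z
  obtain ⟨ι⟩ := exists_tangentSpace_isometry (n := n) z
  have hz : z ∈ T.baseSet := FiberBundle.mem_baseSet_trivializationAt' z
  set A : EuclideanSpace ℝ (Fin n) ≃L[ℝ] EuclideanSpace ℝ (Fin n) :=
    (T.continuousLinearEquivAt ℝ z hz).symm.trans ι.toContinuousLinearEquiv
  have hAn (w) : ‖A w‖ = ‖T.symmL ℝ z w‖ := by
    exact (ι.norm_map _).trans
      (congrArg norm (congrFun (T.symm_continuousLinearEquivAt_eq (R := ℝ) hz) w))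
  have h1 : ∀ᶠ x in 𝓝 z, ∀ v : TangentSpace (𝓡 n) x,
        ‖A (mfderiv (𝓡 n) 𝓘(ℝ, EuclideanSpace ℝ (Fin n)) (extChartAt (𝓡 n) z) x v)‖
          ≤ 2 * ‖v‖ := by
    filter_upwards [eventually_norm_symmL_trivializationAt_self_comp_lt (EuclideanSpace ℝ (Fin n))
      (fun x : M ↦ TangentSpace (𝓡 n) x) z one_lt_two,
      chart_source_mem_nhds (EuclideanSpace ℝ (Fin n)) z] with x hx h1 v
    have := ContinuousLinearMap.le_of_opNorm_le _ hx.le v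
    rw [TangentBundle.continuousLinearMapAt_trivializationAt h1] at this
    exact (hAn _).trans_le this
  refine ⟨A, h1, ?_⟩
  have h2 : ∀ᶠ x in 𝓝 z, ∀ w : EuclideanSpace ℝ (Fin n), ‖T.symmL ℝ x w‖ ≤ 2 * ‖A w‖ ∧
      ‖A w‖ ≤ 2 * ‖T.symmL ℝ x w‖ := by
    filter_upwards [eventually_norm_symmL_trivializationAt_comp_self_lt
      (EuclideanSpace ℝ (Fin n)) (fun x : M ↦ TangentSpace (𝓡 n) x) z one_lt_two,
      chart_source_mem_nhds (EuclideanSpace ℝ (Fin n)) z,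
      eventually_norm_symmL_trivializationAt_self_comp_lt
      (EuclideanSpace ℝ (Fin n)) (fun x : M ↦ TangentSpace (𝓡 n) x) z one_lt_two]
      with x hx hxs hx' w
    constructor
    · have := ContinuousLinearMap.le_of_opNorm_le _ hx.le (T.symmL ℝ z w)
      rw [ContinuousLinearMap.comp_apply] at this
      erw [T.continuousLinearMapAt_symmL hz] at this
      rwa [hAn]
    · have := ContinuousLinearMap.le_of_opNorm_le _ hx'.le (T.symmL ℝ x w)
      rw [ContinuousLinearMap.comp_apply] at this
      erw [T.continuousLinearMapAt_symmL hxs] at this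
      rwa [hAn]
  have hc : Tendsto (extChartAt (𝓡 n) z).symm (𝓝 (extChartAt (𝓡 n) z z)) (𝓝 z) := by
    have := (continuousAt_extChartAt_symm (I := 𝓡 n) z).tendsto
    rwa [extChartAt_to_inv] at this
  filter_upwards [hc.eventually h2, hc.eventually (chart_source_mem_nhds (EuclideanSpace ℝ (Fin n)) z),
    extChartAt_target_mem_nhds z] with y hy hys hyt w
  have := hy w
  rw [TangentBundle.symmL_trivializationAt hys, (extChartAt (𝓡 n) z).right_inv hyt,
    ModelWithCorners.range_eq_univ, mfderivWithin_univ] at this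
  exact this

end AdaptedChart

section Gram

/-- The Gram determinant of the image of the standard basis under a linear map `S` is the squared
determinant of `S`, read in an orthonormal frame of the target. -/
lemma sqrt_det_gram {n : ℕ} {V : Type*} [NormedAddCommGroup V] [InnerProductSpace ℝ V]
    (ι : V ≃ₗᵢ[ℝ] EuclideanSpace ℝ (Fin n)) (S : EuclideanSpace ℝ (Fin n) →ₗ[ℝ] V) :
    √(Matrix.of fun i j : Fin n ↦ inner ℝ (S (EuclideanSpace.single i (1 : ℝ)))
      (S (EuclideanSpace.single j (1 : ℝ)))).det = |LinearMap.det (ι.toLinearMap ∘ₗ S)| := by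
  set b := (EuclideanSpace.basisFun (Fin n) ℝ)
  set B := ι.toLinearMap ∘ₗ S with hB
  have : (Matrix.of fun i j : Fin n ↦ inner ℝ (S (EuclideanSpace.single i (1 : ℝ)))
      (S (EuclideanSpace.single j (1 : ℝ)))) =
      (LinearMap.toMatrix b.toBasis b.toBasis B).transpose *
        LinearMap.toMatrix b.toBasis b.toBasis B := by
    ext i j
    rw [Matrix.mul_apply, Matrix.of_apply, ← ι.inner_map_map]
    simp only [Matrix.transpose_apply, LinearMap.toMatrix_apply]
    rw [PiLp.inner_apply]
    simp [b, hB, mul_comm]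
  rw [this, Matrix.det_mul, Matrix.det_transpose, LinearMap.det_toMatrix, ← sq, Real.sqrt_sq_eq_abs]

/-- If `‖A w‖ ≤ c ‖B w‖` for all `w` then `|det A| ≤ cⁿ |det B|`. -/
lemma abs_det_le_of_norm_le {n : ℕ} {c : ℝ} (hc : 0 ≤ c)
    (A : EuclideanSpace ℝ (Fin n) ≃L[ℝ] EuclideanSpace ℝ (Fin n))
    (B : EuclideanSpace ℝ (Fin n) →ₗ[ℝ] EuclideanSpace ℝ (Fin n)) (h : ∀ w, ‖A w‖ ≤ c * ‖B w‖) :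
    |LinearMap.det (A.toLinearEquiv : EuclideanSpace ℝ (Fin n) →ₗ[ℝ] _)| ≤
      c ^ n * |LinearMap.det B| := by
  have hinj : Function.Injective B := by
    rw [injective_iff_map_eq_zero]
    intro w hw
    have := h w
    rw [hw, norm_zero, mul_zero] at this
    simpa using this
  set Be := LinearEquiv.ofInjectiveEndo B hinj
  have hBe (w) : Be w = B w := rfl
  set T : EuclideanSpace ℝ (Fin n) →ₗ[ℝ] EuclideanSpace ℝ (Fin n) :=
    (A.toLinearEquiv : EuclideanSpace ℝ (Fin n) →ₗ[ℝ] _) ∘ₗ (Be.symm : _ →ₗ[ℝ] _) with hT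
  have hTn (u) : ‖T u‖ ≤ c * ‖u‖ := by
    have := h (Be.symm u)
    rwa [← hBe, Be.apply_symm_apply] at this
  have hTB : (A.toLinearEquiv : EuclideanSpace ℝ (Fin n) →ₗ[ℝ] _) = T ∘ₗ B := by
    ext1 w
    change A w = A (Be.symm (Be w))
    rw [Be.symm_apply_apply]
  rw [hTB, LinearMap.det_comp, abs_mul]
  gcongr
  have h1 := Measure.addHaar_image_linearMap (volume : Measure (EuclideanSpace ℝ (Fin n))) T
    (Metric.closedBall 0 1)
  have h2 : T '' (Metric.closedBall 0 1) ⊆ Metric.closedBall 0 c := by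
    rintro _ ⟨u, hu, rfl⟩
    rw [mem_closedBall_zero_iff] at hu ⊢
    exact (hTn u).trans (mul_le_of_le_one_right hc hu)
  have h3 := measure_mono (μ := volume) h2
  rw [h1, Measure.addHaar_closedBall' _ _ hc, finrank_euclideanSpace, Fintype.card_fin] at h3
  have h4 : volume (Metric.closedBall (0 : EuclideanSpace ℝ (Fin n)) 1) ≠ 0 :=
    (Metric.measure_closedBall_pos _ _ one_pos).ne'
  have h5 : volume (Metric.closedBall (0 : EuclideanSpace ℝ (Fin n)) 1) ≠ ⊤ :=
    measure_closedBall_lt_top.ne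
  rw [ENNReal.mul_le_mul_iff_left h4 h5] at h3
  exact (ENNReal.ofReal_le_ofReal_iff (by positivity)).1 h3

end Gram

/-! ### Distance and volume in a chart -/

section ChartEstimates

variable {n : ℕ} {M : Type*} [MetricSpace M] [ChartedSpace (EuclideanSpace ℝ (Fin n)) M]
  [RiemannianBundle (fun x : M ↦ TangentSpace (𝓡 n) x)] [IsManifold (𝓡 n) 1 M]

/-- The distance between two points of a chart is at most the length of the coordinate segment. -/
lemma dist_extChartAt_symm_le [IsRiemannianManifold (𝓡 n) M] {z : M}
    {y y' : EuclideanSpace ℝ (Fin n)} {C : ℝ}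
    (ht : segment ℝ y y' ⊆ (extChartAt (𝓡 n) z).target)
    (hC : ∀ u ∈ segment ℝ y y',
      ‖(mfderiv 𝓘(ℝ, EuclideanSpace ℝ (Fin n)) (𝓡 n) (extChartAt (𝓡 n) z).symm u (y' - y) :
          TangentSpace (𝓡 n) ((extChartAt (𝓡 n) z).symm u))‖ ≤ C) :
    dist ((extChartAt (𝓡 n) z).symm y) ((extChartAt (𝓡 n) z).symm y') ≤ C := by
  have hC0 : 0 ≤ C := (norm_nonneg _).trans (hC y (left_mem_segment ℝ y y'))
  let η : ℝ →ᴬ[ℝ] EuclideanSpace ℝ (Fin n) := ContinuousAffineMap.lineMap (R := ℝ) y y'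
  set γ := (extChartAt (𝓡 n) z).symm ∘ η
  have hη : ∀ t ∈ Icc (0 : ℝ) 1, η t ∈ segment ℝ y y' := fun t ht ↦ by
    rw [segment_eq_image_lineMap]
    exact ⟨t, ht, by simp [η, ContinuousAffineMap.coe_lineMap_eq]⟩
  have η_smooth : ContMDiff 𝓘(ℝ, ℝ) 𝓘(ℝ, EuclideanSpace ℝ (Fin n)) 1 η := by
    rw [contMDiff_iff_contDiff]
    exact ContinuousAffineMap.contDiff _
  have h1 : riemannianEDist (𝓡 n) ((extChartAt (𝓡 n) z).symm y)
      ((extChartAt (𝓡 n) z).symm y') ≤ pathELength (𝓡 n) γ 0 1 := by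
    apply riemannianEDist_le_pathELength _ _ _ zero_le_one
    · exact (contMDiffOn_extChartAt_symm z).comp η_smooth.contMDiffOn (fun t h ↦ ht (hη t h))
    · simp [γ, η, ContinuousAffineMap.coe_lineMap_eq]
    · simp [γ, η, ContinuousAffineMap.coe_lineMap_eq]
  have h2 : pathELength (𝓡 n) γ 0 1 ≤ ENNReal.ofReal C := by
    rw [pathELength_eq_lintegral_mfderiv_Ioo]
    calc ∫⁻ t in Ioo (0 : ℝ) 1, ‖mfderiv 𝓘(ℝ, ℝ) (𝓡 n) γ t 1‖ₑ
        ≤ ∫⁻ t in Ioo (0 : ℝ) 1, ENNReal.ofReal C := by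
          refine setLIntegral_mono' measurableSet_Ioo fun t h ↦ ?_
          have hs := hη t (Ioo_subset_Icc_self h)
          have hd : MDifferentiableAt 𝓘(ℝ, EuclideanSpace ℝ (Fin n)) (𝓡 n)
              (extChartAt (𝓡 n) z).symm (η t) := by
            have := mdifferentiableWithinAt_extChartAt_symm (I := 𝓡 n) (ht hs)
            rwa [ModelWithCorners.range_eq_univ, mdifferentiableWithinAt_univ] at this
          have hd' : MDifferentiableAt 𝓘(ℝ, ℝ) 𝓘(ℝ, EuclideanSpace ℝ (Fin n)) η t :=
            η_smooth.mdifferentiable one_ne_zero t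
          have e1 : mfderiv 𝓘(ℝ, ℝ) 𝓘(ℝ, EuclideanSpace ℝ (Fin n)) η t (1 : ℝ) = y' - y := by
            rw [mfderiv_eq_fderiv]
            have : (η : ℝ → EuclideanSpace ℝ (Fin n)) = AffineMap.lineMap y y' := by
              ext; simp [η, ContinuousAffineMap.coe_lineMap_eq]
            rw [this]
            rw [(AffineMap.hasDerivAt_lineMap (a := y) (b := y') (x := t)).hasFDerivAt.fderiv]
            exact one_smul ℝ (y' - y)
          have e2 := mfderiv_comp_apply t hd hd' (1 : ℝ)
          have e3 : mfderiv 𝓘(ℝ, ℝ) (𝓡 n) γ t (1 : ℝ) =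
            mfderiv 𝓘(ℝ, EuclideanSpace ℝ (Fin n)) (𝓡 n) (extChartAt (𝓡 n) z).symm (η t)
              (y' - y) := e2.trans (by rw [e1])
          rw [← ofReal_norm]
          refine ENNReal.ofReal_le_ofReal ?_
          refine le_trans (le_of_eq ?_) (hC _ hs)
          exact congrArg norm e3
      _ = ENNReal.ofReal C := by simp
  have h3 := h1.trans h2
  rw [← IsRiemannianManifold.out, edist_dist] at h3
  exact (ENNReal.ofReal_le_ofReal_iff hC0).1 h3

/-- A chart at `z` in which the metric is comparable, with the universal factor `2`, to a constant
Euclidean metric `‖A ·‖`: both norms on tangent vectors and the distance are controlled. -/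
lemma exists_adapted_chart [IsRiemannianManifold (𝓡 n) M]
    [IsContinuousRiemannianBundle (EuclideanSpace ℝ (Fin n))
      (fun x : M ↦ TangentSpace (𝓡 n) x)] (z : M) :
    ∃ A : EuclideanSpace ℝ (Fin n) ≃L[ℝ] EuclideanSpace ℝ (Fin n), ∃ ρ > 0,
      ∀ y, ‖A (y - extChartAt (𝓡 n) z z)‖ < ρ → y ∈ (extChartAt (𝓡 n) z).target ∧
        (∀ v : TangentSpace (𝓡 n) ((extChartAt (𝓡 n) z).symm y),
          ‖A (mfderiv (𝓡 n) 𝓘(ℝ, EuclideanSpace ℝ (Fin n)) (extChartAt (𝓡 n) z)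
            ((extChartAt (𝓡 n) z).symm y) v)‖ ≤ 2 * ‖v‖) ∧
        (∀ w : EuclideanSpace ℝ (Fin n), ‖A w‖ ≤ 2 *
          ‖(mfderiv 𝓘(ℝ, EuclideanSpace ℝ (Fin n)) (𝓡 n) (extChartAt (𝓡 n) z).symm y w :
          TangentSpace (𝓡 n) ((extChartAt (𝓡 n) z).symm y))‖) ∧
        ∀ y', ‖A (y' - extChartAt (𝓡 n) z z)‖ < ρ →
          dist ((extChartAt (𝓡 n) z).symm y) ((extChartAt (𝓡 n) z).symm y')
            ≤ 2 * ‖A (y' - y)‖ := by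
  obtain ⟨A, h1, h2⟩ := exists_adapted_linear_equiv (n := n) z
  have hc : Tendsto (extChartAt (𝓡 n) z).symm (𝓝 (extChartAt (𝓡 n) z z)) (𝓝 z) := by
    have := (continuousAt_extChartAt_symm (I := 𝓡 n) z).tendsto
    rwa [extChartAt_to_inv] at this
  have h3 := ((hc.eventually h1).and h2).and (extChartAt_target_mem_nhds (I := 𝓡 n) z)
  have hsub : ∀ y, ‖A (y - extChartAt (𝓡 n) z z)‖ = dist (A y) (A (extChartAt (𝓡 n) z z)) :=
    fun y ↦ by rw [map_sub, dist_eq_norm]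
  have h4 : ∀ᶠ u in 𝓝 (A (extChartAt (𝓡 n) z z)), _ :=
    (A.symm.continuous.tendsto' (A (extChartAt (𝓡 n) z z)) (extChartAt (𝓡 n) z z)
      (A.symm_apply_apply _)).eventually h3
  obtain ⟨ρ, hρ, h5⟩ := Metric.eventually_nhds_iff.1 h4
  refine ⟨A, ρ, hρ, fun y hy ↦ ?_⟩
  have key : ∀ y, ‖A (y - extChartAt (𝓡 n) z z)‖ < ρ → _ := fun y hy ↦ by
    have := h5 (y := A y) (by rwa [← hsub])
    rwa [A.symm_apply_apply] at this
  obtain ⟨⟨k1, k2⟩, k3⟩ := key y hy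
  refine ⟨k3, k1, fun w ↦ (k2 w).2, fun y' hy' ↦ ?_⟩
  have hseg : ∀ u ∈ segment ℝ y y', ‖A (u - extChartAt (𝓡 n) z z)‖ < ρ := by
    have hconv : Convex ℝ (A ⁻¹' (Metric.ball (A (extChartAt (𝓡 n) z z)) ρ)) :=
      (convex_ball _ _).linear_preimage A.toLinearEquiv.toLinearMap
    intro u hu
    rw [hsub] at hy hy' ⊢
    exact hconv.segment_subset hy hy' hu
  exact dist_extChartAt_symm_le (fun u hu ↦ (key u (hseg u hu)).2)
    fun u hu ↦ ((key u (hseg u hu)).1.2 _).1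

/-- Small balls around any point have at least Euclidean volume, up to the factor `4⁻ⁿ`. -/
lemma exists_le_riemannianVolume_ball [IsRiemannianManifold (𝓡 n) M]
    [IsContinuousRiemannianBundle (EuclideanSpace ℝ (Fin n))
      (fun x : M ↦ TangentSpace (𝓡 n) x)] [MeasurableSpace M] [BorelSpace M] (z : M) :
    ∃ r₀ > 0, ∀ r, 0 < r → r ≤ r₀ →
      ENNReal.ofReal ((r / 4) ^ n) * volume (Metric.ball (0 : EuclideanSpace ℝ (Fin n)) 1) ≤
        riemannianVolume n M (Metric.ball z r) := by
  -- In an adapted chart, the ellipsoid `U = {‖A (y - e z)‖ < r / 2}` is mapped into the ball of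
  -- radius `r`, and the volume density on it is at least `|det A| / 2ⁿ`.
  obtain ⟨A, ρ, hρ, h⟩ := exists_adapted_chart (n := n) z
  refine ⟨ρ, hρ, fun r hr hrρ ↦ ?_⟩
  set e := extChartAt (𝓡 n) z
  set U : Set (EuclideanSpace ℝ (Fin n)) :=
    (A.toLinearEquiv : EuclideanSpace ℝ (Fin n) →ₗ[ℝ] _) ⁻¹' Metric.ball (A (e z)) (r / 2) with hU
  have hUm : MeasurableSet U := A.continuous.measurable measurableSet_ball
  have hUn : ∀ y ∈ U, ‖A (y - e z)‖ < r / 2 := fun y hy ↦ by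
    rw [map_sub, ← dist_eq_norm]; exact hy
  have hz0 : ‖A (e z - e z)‖ < ρ := by simpa using hρ
  have hUt : U ⊆ e.target := fun y hy ↦ (h y (by linarith [hUn y hy])).1
  have hUb : U ⊆ e.symm ⁻¹' Metric.ball z r := fun y hy ↦ by
    have := (h (e z) hz0).2.2.2 y (by linarith [hUn y hy])
    rw [extChartAt_to_inv] at this
    rw [mem_preimage, Metric.mem_ball']
    linarith [hUn y hy]
  have hdet : LinearMap.det (A.toLinearEquiv : EuclideanSpace ℝ (Fin n) →ₗ[ℝ] _) ≠ 0 :=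
    (LinearEquiv.isUnit_det' A.toLinearEquiv).ne_zero
  have hUvol : volume U = ENNReal.ofReal
      |(LinearMap.det (A.toLinearEquiv : EuclideanSpace ℝ (Fin n) →ₗ[ℝ] _))⁻¹| *
      (ENNReal.ofReal ((r / 2) ^ n) * volume (Metric.ball (0 : EuclideanSpace ℝ (Fin n)) 1)) := by
    rw [hU, Measure.addHaar_preimage_linearMap _ hdet, Measure.addHaar_ball_of_pos _ _ (by positivity),
      finrank_euclideanSpace, Fintype.card_fin]
  set d := |LinearMap.det (A.toLinearEquiv : EuclideanSpace ℝ (Fin n) →ₗ[ℝ] _)| with hd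
  have hd0 : 0 < d := abs_pos.2 hdet
  have hdens : ∀ y ∈ U, ENNReal.ofReal (d / 2 ^ n) ≤
      ENNReal.ofReal (√(metricMatrix n z y).det) := fun y hy ↦ by
    refine ENNReal.ofReal_le_ofReal ?_
    obtain ⟨ι⟩ := exists_tangentSpace_isometry (n := n) (e.symm y)
    let S : EuclideanSpace ℝ (Fin n) →ₗ[ℝ] TangentSpace (𝓡 n) (e.symm y) :=
      (mfderiv 𝓘(ℝ, EuclideanSpace ℝ (Fin n)) (𝓡 n) e.symm y :
        EuclideanSpace ℝ (Fin n) →L[ℝ] TangentSpace (𝓡 n) (e.symm y)).toLinearMap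
    have e1 : √(metricMatrix n z y).det = |LinearMap.det (ι.toLinearMap ∘ₗ S)| :=
      sqrt_det_gram ι S
    rw [e1, div_le_iff₀' (by positivity)]
    refine abs_det_le_of_norm_le zero_le_two A _ fun w ↦ ?_
    refine ((h y (by linarith [hUn y hy])).2.2.1 w).trans (le_of_eq ?_)
    exact congrArg (2 * ·) (ι.norm_map _).symm
  calc ENNReal.ofReal ((r / 4) ^ n) * volume (Metric.ball (0 : EuclideanSpace ℝ (Fin n)) 1)
      = ENNReal.ofReal (d / 2 ^ n) * volume U := by
        rw [hUvol, ← mul_assoc, ← mul_assoc, ← ENNReal.ofReal_mul (by positivity),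
          ← ENNReal.ofReal_mul (by positivity), abs_inv, ← hd]
        congr 2
        rw [div_pow, div_pow, show (4 : ℝ) = 2 * 2 by norm_num, mul_pow]
        field_simp
    _ = ∫⁻ y in U, ENNReal.ofReal (d / 2 ^ n) := by rw [setLIntegral_const]
    _ ≤ ∫⁻ y in U, ENNReal.ofReal (√(metricMatrix n z y).det) :=
        setLIntegral_mono' hUm hdens
    _ ≤ ∫⁻ y in e.symm ⁻¹' Metric.ball z r, ENNReal.ofReal (√(metricMatrix n z y).det)
          ∂(volume.restrict e.target) := by
        refine lintegral_mono' ?_ le_rfl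
        rw [← inter_eq_left.2 hUt, ← Measure.restrict_restrict hUm]
        exact Measure.restrict_mono hUb le_rfl
    _ = chartVolume n z (Metric.ball z r) := by
        rw [chartVolume, Measure.map_apply_of_aemeasurable _ measurableSet_ball,
          withDensity_apply']
        exact ((continuousOn_extChartAt_symm z).aemeasurable
          (isOpen_extChartAt_target z).measurableSet).mono_ac (withDensity_absolutelyContinuous _ _)
    _ ≤ riemannianVolume n M (Metric.ball z r) :=
        Measure.le_iff'.1 (le_iSup (fun x : M ↦ chartVolume n x) z) _

end ChartEstimates

/-! ### Mollification and the differential of a function -/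

section Mollification

/-- Convolution with a smooth bump approximates Lipschitz functions without increasing the
Lipschitz constant. -/
lemma exists_contDiff_lipschitzWith {V : Type*} [NormedAddCommGroup V] [NormedSpace ℝ V]
    [FiniteDimensional ℝ V] {f : V → ℝ} {K : ℝ≥0} (hf : LipschitzWith K f) {ε : ℝ} (hε : 0 < ε) :
    ∃ g : V → ℝ, ContDiff ℝ ∞ g ∧ LipschitzWith K g ∧ ∀ a, |g a - f a| ≤ ε := by
  borelize V
  set μ : Measure V := Measure.addHaar
  -- A bump of radius `δ` moves a `K`-Lipschitz function by at most `K δ ≤ ε`.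
  set δ : ℝ := ε / (K + 1)
  have hK : (0 : ℝ) ≤ K := K.2
  have hδ : 0 < δ := by positivity
  set φ : ContDiffBump (0 : V) := ⟨δ / 2, δ, half_pos hδ, half_lt_self hδ⟩
  set g := MeasureTheory.convolution (φ.normed μ) f (ContinuousLinearMap.lsmul ℝ ℝ) μ with hg
  have hloc : LocallyIntegrable f μ := hf.continuous.locallyIntegrable
  have hint (a : V) : Integrable (fun t ↦ φ.normed μ t * f (a - t)) μ := by
    have hc : Continuous fun t ↦ φ.normed μ t * f (a - t) :=
      φ.continuous_normed.mul (hf.continuous.comp (continuous_const.sub continuous_id))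
    exact hc.integrable_of_hasCompactSupport φ.hasCompactSupport_normed.mul_right
  have hga (a : V) : g a = ∫ t, φ.normed μ t * f (a - t) ∂μ := by
    simp [hg, MeasureTheory.convolution]
  refine ⟨g, φ.hasCompactSupport_normed.contDiff_convolution_left _ φ.contDiff_normed hloc,
    LipschitzWith.of_dist_le_mul fun a b ↦ ?_, fun a ↦ ?_⟩
  · rw [Real.dist_eq, hga, hga, ← integral_sub (hint a) (hint b)]
    calc |∫ t, φ.normed μ t * f (a - t) - φ.normed μ t * f (b - t) ∂μ|
        ≤ ∫ t, φ.normed μ t * (K * dist a b) ∂μ := by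
          rw [← Real.norm_eq_abs]
          refine norm_integral_le_of_norm_le (φ.integrable_normed.mul_const _) ?_
          refine Eventually.of_forall fun t ↦ ?_
          rw [← mul_sub, norm_mul, Real.norm_of_nonneg (φ.nonneg_normed t)]
          refine mul_le_mul_of_nonneg_left ?_ (φ.nonneg_normed t)
          have := hf.dist_le_mul (a - t) (b - t)
          rwa [dist_sub_right] at this
      _ = K * dist a b := by
          rw [integral_mul_const, φ.integral_normed, one_mul]
  · have h : dist (g a) (f a) ≤ ε := by
      refine φ.dist_normed_convolution_le hf.continuous.aestronglyMeasurable fun x hx ↦ ?_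
      calc dist (f x) (f a) ≤ K * dist x a := hf.dist_le_mul _ _
        _ ≤ K * δ := mul_le_mul_of_nonneg_left (Metric.mem_ball.1 hx).le hK
        _ ≤ ε := by
          simp only [δ]
          rw [mul_div_assoc', div_le_iff₀ (by positivity)]
          nlinarith
    rwa [Real.dist_eq] at h

end Mollification

section Differential

variable {n : ℕ} {M : Type*} [TopologicalSpace M] [ChartedSpace (EuclideanSpace ℝ (Fin n)) M]

lemma differential_congr {φ ψ : M → ℝ} {x : M} (h : φ =ᶠ[𝓝 x] ψ) :
    differential n φ x = differential n ψ x := by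
  ext v
  have := h.mfderiv_eq (I := 𝓡 n) (I' := 𝓘(ℝ, ℝ))
  exact congrArg (fun L : EuclideanSpace ℝ (Fin n) →L[ℝ] ℝ ↦ L v) this

lemma differential_const (c : ℝ) (x : M) (v : TangentSpace (𝓡 n) x) :
    differential n (fun _ : M ↦ c) x v = 0 := by
  have : mfderiv (𝓡 n) 𝓘(ℝ, ℝ) (fun _ : M ↦ c) x = 0 := mfderiv_const
  exact congrArg (fun L : EuclideanSpace ℝ (Fin n) →L[ℝ] ℝ ↦ L v) this

lemma differential_comp {h : ℝ → ℝ} {φ : M → ℝ} {x : M}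
    (hh : DifferentiableAt ℝ h (φ x)) (hφ : MDifferentiableAt (𝓡 n) 𝓘(ℝ, ℝ) φ x)
    (v : TangentSpace (𝓡 n) x) :
    differential n (h ∘ φ) x v = deriv h (φ x) * differential n φ x v := by
  have e := mfderiv_comp_apply x hh.mdifferentiableAt hφ v
  rw [mfderiv_eq_fderiv] at e
  have e' : fderiv ℝ h (φ x) (differential n φ x v) =
      deriv h (φ x) * differential n φ x v := by
    rw [fderiv_eq_smul_deriv, smul_eq_mul, mul_comm]
  exact e.trans e'

/-- The product rule. The second factor may fail to be differentiable away from the support of the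
first one: both sides vanish there, whatever the junk value of its differential. -/
lemma differential_mul {χ φ : M → ℝ} {x : M} (hχ : MDifferentiableAt (𝓡 n) 𝓘(ℝ, ℝ) χ x)
    (hφ : x ∈ tsupport χ → MDifferentiableAt (𝓡 n) 𝓘(ℝ, ℝ) φ x) :
    MDifferentiableAt (𝓡 n) 𝓘(ℝ, ℝ) (χ * φ) x ∧ ∀ v : TangentSpace (𝓡 n) x,
      differential n (χ * φ) x v = χ x * differential n φ x v + φ x * differential n χ x v := by
  by_cases hx : x ∈ tsupport χ
  · have := hχ.hasMFDerivAt.mul (hφ hx).hasMFDerivAt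
    refine ⟨this.mdifferentiableAt, fun v ↦ ?_⟩
    exact congrArg (fun L : EuclideanSpace ℝ (Fin n) →L[ℝ] ℝ ↦ L v) this.mfderiv
  · have h0 : χ =ᶠ[𝓝 x] fun _ ↦ 0 := notMem_tsupport_iff_eventuallyEq.1 hx
    have h1 : χ * φ =ᶠ[𝓝 x] fun _ ↦ 0 := by
      filter_upwards [h0] with y hy
      simp [hy]
    refine ⟨mdifferentiableAt_const.congr_of_eventuallyEq h1, fun v ↦ ?_⟩
    rw [differential_congr h0, differential_congr h1, differential_const, h0.eq_of_nhds]
    simp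

lemma differential_sum {ι : Type*} (t : Finset ι) {φ : ι → M → ℝ} {x : M}
    (hφ : ∀ i ∈ t, MDifferentiableAt (𝓡 n) 𝓘(ℝ, ℝ) (φ i) x) :
    MDifferentiableAt (𝓡 n) 𝓘(ℝ, ℝ) (∑ i ∈ t, φ i) x ∧ ∀ v : TangentSpace (𝓡 n) x,
      differential n (∑ i ∈ t, φ i) x v = ∑ i ∈ t, differential n (φ i) x v := by
  classical
  induction t using Finset.induction_on with
  | empty =>
    simp only [Finset.sum_empty]
    exact ⟨mdifferentiableAt_const, differential_const 0 x⟩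
  | insert i t hi ih =>
    obtain ⟨h1, h2⟩ := ih fun j hj ↦ hφ j (Finset.mem_insert_of_mem hj)
    have := (hφ i (Finset.mem_insert_self i t)).hasMFDerivAt.add h1.hasMFDerivAt
    simp only [Finset.sum_insert hi]
    refine ⟨this.mdifferentiableAt, fun v ↦ ?_⟩
    rw [← h2]
    exact congrArg (fun L : EuclideanSpace ℝ (Fin n) →L[ℝ] ℝ ↦ L v) this.mfderiv

variable [RiemannianBundle (fun x : M ↦ TangentSpace (𝓡 n) x)]

lemma gradNorm_le_of_forall {φ : M → ℝ} {x : M} {C : ℝ} (hC : 0 ≤ C)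
    (h : ∀ v : TangentSpace (𝓡 n) x, |differential n φ x v| ≤ C * ‖v‖) : gradNorm n φ x ≤ C :=
  ContinuousLinearMap.opNorm_le_bound _ hC h

lemma abs_differential_le (φ : M → ℝ) (x : M) (v : TangentSpace (𝓡 n) x) :
    |differential n φ x v| ≤ gradNorm n φ x * ‖v‖ :=
  ContinuousLinearMap.le_opNorm (differential n φ x) v

lemma gradNorm_nonneg (φ : M → ℝ) (x : M) : 0 ≤ gradNorm n φ x :=
  norm_nonneg (differential n φ x)

lemma gradNorm_congr {φ ψ : M → ℝ} {x : M} (h : φ =ᶠ[𝓝 x] ψ) :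
    gradNorm n φ x = gradNorm n ψ x := by
  rw [gradNorm, differential_congr h, gradNorm]

lemma gradNorm_const (c : ℝ) (x : M) : gradNorm n (fun _ : M ↦ c) x = 0 :=
  le_antisymm (gradNorm_le_of_forall le_rfl fun v ↦ by simp [differential_const])
    (gradNorm_nonneg _ _)

end Differential

section Smoothing

variable {n : ℕ} {M : Type*} [TopologicalSpace M] [ChartedSpace (EuclideanSpace ℝ (Fin n)) M]
  [RiemannianBundle (fun x : M ↦ TangentSpace (𝓡 n) x)] [IsManifold (𝓡 n) 1 M]

/-- Gradient bound for a function that is read in a chart, followed by a linear map `A`, as `g`. -/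
lemma gradNorm_comp_extChartAt_le {z x : M} {g : EuclideanSpace ℝ (Fin n) → ℝ} {L c : ℝ}
    (A : EuclideanSpace ℝ (Fin n) ≃L[ℝ] EuclideanSpace ℝ (Fin n))
    (hx : x ∈ (chartAt (EuclideanSpace ℝ (Fin n)) z).source)
    (hA : ∀ v : TangentSpace (𝓡 n) x,
      ‖A (mfderiv (𝓡 n) 𝓘(ℝ, EuclideanSpace ℝ (Fin n)) (extChartAt (𝓡 n) z) x v)‖ ≤ c * ‖v‖)
    (hg : DifferentiableAt ℝ g (A (extChartAt (𝓡 n) z x)))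
    (hL : ‖fderiv ℝ g (A (extChartAt (𝓡 n) z x))‖ ≤ L) (hc : 0 ≤ c) :
    gradNorm n (fun x ↦ g (A (extChartAt (𝓡 n) z x))) x ≤ L * c := by
  have hL0 : 0 ≤ L := (norm_nonneg _).trans hL
  refine gradNorm_le_of_forall (by positivity) fun v ↦ ?_
  have hd : HasFDerivAt (fun y ↦ g (A y)) ((fderiv ℝ g (A (extChartAt (𝓡 n) z x))).comp
      (A : EuclideanSpace ℝ (Fin n) →L[ℝ] EuclideanSpace ℝ (Fin n))) (extChartAt (𝓡 n) z x) :=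
    hg.hasFDerivAt.comp _ A.hasFDerivAt
  have e := mfderiv_comp_apply x hd.differentiableAt.mdifferentiableAt
    (mdifferentiableAt_extChartAt (I := 𝓡 n) hx) v
  rw [mfderiv_eq_fderiv, hd.fderiv] at e
  have e' : |differential n (fun x ↦ g (A (extChartAt (𝓡 n) z x))) x v| =
      ‖fderiv ℝ g (A (extChartAt (𝓡 n) z x))
        (A (mfderiv (𝓡 n) 𝓘(ℝ, EuclideanSpace ℝ (Fin n)) (extChartAt (𝓡 n) z) x v))‖ :=
    congrArg (fun r : ℝ ↦ |r|) e
  rw [e', mul_assoc]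
  exact (ContinuousLinearMap.le_of_opNorm_le _ hL _).trans
    (mul_le_mul_of_nonneg_left (hA v) hL0)

end Smoothing

/-! ### Smooth approximation of Lipschitz functions -/

section Smoothing

variable {n : ℕ} {M : Type*} [MetricSpace M] [ChartedSpace (EuclideanSpace ℝ (Fin n)) M]
  [RiemannianBundle (fun x : M ↦ TangentSpace (𝓡 n) x)] [IsManifold (𝓡 n) ∞ M]
  [IsContinuousRiemannianBundle (EuclideanSpace ℝ (Fin n)) (fun x : M ↦ TangentSpace (𝓡 n) x)]

lemma exists_gradNorm_le_of_isCompact {φ : M → ℝ} (hφ : ContMDiff (𝓡 n) 𝓘(ℝ, ℝ) ∞ φ)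
    {K : Set M} (hK : IsCompact K) : ∃ C, 0 ≤ C ∧ ∀ x ∈ K, gradNorm n φ x ≤ C := by
  refine hK.induction_on (p := fun s ↦ ∃ C, 0 ≤ C ∧ ∀ x ∈ s, gradNorm n φ x ≤ C)
    ⟨0, le_rfl, by simp⟩ (fun s t hst ⟨C, h0, hC⟩ ↦ ⟨C, h0, fun x hx ↦ hC x (hst hx)⟩)
    (fun s t ⟨C, h0, hC⟩ ⟨D, h0', hD⟩ ↦ ⟨max C D, le_max_of_le_left h0, fun x hx ↦ ?_⟩)
    fun z _ ↦ ?_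
  · rcases hx with hx | hx
    · exact (hC x hx).trans (le_max_left _ _)
    · exact (hD x hx).trans (le_max_right _ _)
  obtain ⟨A, hA, -⟩ := exists_adapted_linear_equiv (n := n) z
  set e := extChartAt (𝓡 n) z with he
  set g : EuclideanSpace ℝ (Fin n) → ℝ := fun u ↦ φ (e.symm (A.symm u)) with hg
  set V : Set (EuclideanSpace ℝ (Fin n)) := A.symm ⁻¹' e.target
  have hV : IsOpen V := (isOpen_extChartAt_target z).preimage A.symm.continuous
  have hgs : ContDiffOn ℝ ∞ g V := by
    have h1 : ContMDiffOn 𝓘(ℝ, EuclideanSpace ℝ (Fin n)) 𝓘(ℝ, ℝ) ∞ (φ ∘ e.symm) e.target :=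
      hφ.comp_contMDiffOn (contMDiffOn_extChartAt_symm z)
    rw [contMDiffOn_iff_contDiffOn] at h1
    exact h1.comp A.symm.contDiff.contDiffOn (fun u hu ↦ hu)
  have hmem : A (e z) ∈ V := by
    rw [mem_preimage, A.symm_apply_apply]
    exact mem_extChartAt_target z
  have hcont : ContinuousAt (fun u ↦ ‖fderiv ℝ g u‖) (A (e z)) :=
    ((hgs.continuousOn_fderiv_of_isOpen hV (by simp)).continuousAt (hV.mem_nhds hmem)).norm
  set C := ‖fderiv ℝ g (A (e z))‖ + 1
  have hC : 0 ≤ C := by positivity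
  have h2 : ∀ᶠ u in 𝓝 (A (e z)), ‖fderiv ℝ g u‖ ≤ C ∧ u ∈ V :=
    (hcont.eventually_le_const (lt_add_one _)).and (hV.mem_nhds hmem)
  have h3 : Tendsto (fun x ↦ A (e x)) (𝓝 z) (𝓝 (A (e z))) :=
    A.continuous.continuousAt.comp (continuousAt_extChartAt z)
  refine ⟨_, mem_nhdsWithin_of_mem_nhds ((hA.and (h3.eventually h2)).and
    (chart_source_mem_nhds (EuclideanSpace ℝ (Fin n)) z)), C * 2, by positivity, ?_⟩
  rintro x ⟨⟨hx1, hx2, hx3⟩, hx4⟩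
  have hev : φ =ᶠ[𝓝 x] fun x ↦ g (A (e x)) := by
    filter_upwards [(chartAt (EuclideanSpace ℝ (Fin n)) z).open_source.mem_nhds hx4] with y hy
    simp only [hg, A.symm_apply_apply]
    rw [e.left_inv (by rwa [he, extChartAt_source])]
  rw [gradNorm_congr hev]
  exact gradNorm_comp_extChartAt_le A hx4 hx1
    ((hgs.contDiffAt (hV.mem_nhds hx3)).differentiableAt (by simp)) hx2 zero_le_two

variable [IsRiemannianManifold (𝓡 n) M]

variable (n) in
/-- Around every point, `1`-Lipschitz functions are uniform limits of smooth functions with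
gradient bounded by a universal constant. -/
lemma exists_local_smoothing (z : M) : ∃ U : Set M, IsOpen U ∧ z ∈ U ∧
    ∀ f : M → ℝ, LipschitzWith 1 f → ∀ ε : ℝ, 0 < ε → ∃ F : M → ℝ,
      ContMDiffOn (𝓡 n) 𝓘(ℝ, ℝ) ∞ F U ∧ ∀ x ∈ U, |F x - f x| ≤ ε ∧ gradNorm n F x ≤ 4 := by
  obtain ⟨A, ρ, hρ, hA⟩ := exists_adapted_chart (n := n) z
  set e := extChartAt (𝓡 n) z with he
  set B : Set (EuclideanSpace ℝ (Fin n)) := Metric.ball (A (e z)) ρ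
  have hBA (x : M) (hx : A (e x) ∈ B) : ‖A (e x - e z)‖ < ρ := by
    rw [map_sub, ← dist_eq_norm]; exact hx
  have hBA' (u) (hu : u ∈ B) : ‖A (A.symm u - e z)‖ < ρ := by
    rw [map_sub, A.apply_symm_apply, ← dist_eq_norm]; exact hu
  refine ⟨e.source ∩ e ⁻¹' (A ⁻¹' B),
    (continuousOn_extChartAt z).isOpen_inter_preimage (isOpen_extChartAt_source z)
      (Metric.isOpen_ball.preimage A.continuous), ⟨mem_extChartAt_source z, by simp [B, hρ]⟩, ?_⟩
  intro f hf ε hε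
  have hL : LipschitzOnWith 2 (fun u ↦ f (e.symm (A.symm u))) B := by
    refine LipschitzOnWith.of_dist_le_mul fun u hu w hw ↦ ?_
    have h1 := (hA _ (hBA' u hu)).2.2.2 _ (hBA' w hw)
    rw [map_sub, A.apply_symm_apply, A.apply_symm_apply, ← dist_eq_norm, dist_comm w u] at h1
    have h2 := hf.dist_le_mul (e.symm (A.symm u)) (e.symm (A.symm w))
    rw [NNReal.coe_one, one_mul] at h2
    exact h2.trans h1
  obtain ⟨h, hh, hhB⟩ := hL.extend_real
  obtain ⟨g, hg, hgL, hgh⟩ := exists_contDiff_lipschitzWith hh hε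
  refine ⟨fun x ↦ g (A (e x)), ?_, fun x hx ↦ ⟨?_, ?_⟩⟩
  · have h1 : ContMDiff 𝓘(ℝ, EuclideanSpace ℝ (Fin n)) 𝓘(ℝ, ℝ) ∞ (fun y ↦ g (A y)) :=
      (hg.comp A.contDiff).contMDiff
    refine h1.comp_contMDiffOn (contMDiffOn_extChartAt.mono fun x hx ↦ ?_)
    simpa [he] using hx.1
  · have := hgh (A (e x))
    rw [← hhB hx.2] at this
    simpa only [A.symm_apply_apply, e.left_inv hx.1] using this
  · have hs : x ∈ (chartAt (EuclideanSpace ℝ (Fin n)) z).source := by simpa [he] using hx.1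
    have h1 := (hA _ (hBA x hx.2)).2.1
    rw [e.left_inv hx.1] at h1
    have h2 : ‖fderiv ℝ g (A (e x))‖ ≤ 2 := norm_fderiv_le_of_lipschitz ℝ hgL
    have := gradNorm_comp_extChartAt_le A hs h1 (hg.differentiable (by simp) _) h2 zero_le_two
    linarith

variable (n) in
/-- On a compact set, `1`-Lipschitz functions are uniform limits of smooth functions with
gradient bounded by a universal constant: local smooth approximations are glued by a partition of
unity `χ`, and since `∑ dχᵢ = 0` the error terms `∑ Fᵢ dχᵢ = ∑ (Fᵢ - f) dχᵢ` are small. -/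
lemma exists_smoothing [ProperSpace M] {f : M → ℝ} (hf : LipschitzWith 1 f) {K : Set M}
    (hK : IsCompact K) {ε : ℝ} (hε : 0 < ε) :
    ∃ F : M → ℝ, ContMDiff (𝓡 n) 𝓘(ℝ, ℝ) ∞ F ∧ (∀ x ∈ K, |F x - f x| ≤ ε) ∧
      ∀ x ∈ interior K, gradNorm n F x ≤ 5 := by
  choose U hUo hUm hU using exists_local_smoothing (n := n) (M := M)
  obtain ⟨t, ht⟩ := hK.elim_finite_subcover U hUo (fun x _ ↦ mem_iUnion.2 ⟨x, hUm x⟩)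
  obtain ⟨χ, hχ⟩ := SmoothPartitionOfUnity.exists_isSubordinate (𝓡 n) hK.isClosed
    (fun i : t ↦ U i) (fun i ↦ hUo i) (fun x hx ↦ by simpa using ht hx)
  choose C hC0 hC using fun i : t ↦
    exists_gradNorm_le_of_isCompact (n := n) (χ i).contMDiff hK
  set D := ∑ i, C i
  have hD : 0 ≤ D := Finset.sum_nonneg fun i _ ↦ hC0 i
  set δ := min ε (1 / (D + 1))
  have hδ : 0 < δ := lt_min hε (by positivity)
  have hδD : δ * D ≤ 1 := by
    calc δ * D ≤ 1 / (D + 1) * D := mul_le_mul_of_nonneg_right (min_le_right _ _) hD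
      _ ≤ 1 := by rw [one_div_mul_eq_div, div_le_one (by positivity)]; linarith
  choose F hFs hF using fun i : t ↦ hU i f hf δ hδ
  set G : M → ℝ := ∑ i, (χ i : M → ℝ) * F i with hG
  have hGs : ContMDiff (𝓡 n) 𝓘(ℝ, ℝ) ∞ G := by
    have := hχ.contMDiff_finsum_smul (g := F) (n := ⊤) (fun i ↦ hUo i) hFs
    convert this using 1
    ext x
    rw [finsum_eq_sum_of_fintype, hG]
    simp
  have hsupp : ∀ (i : t) x, χ i x ≠ 0 → x ∈ U i := fun i x hx ↦
    hχ i (subset_tsupport _ hx)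
  have hsum : ∀ x ∈ K, ∑ i, χ i x = 1 := fun x hx ↦ by
    rw [← finsum_eq_sum_of_fintype]; exact χ.sum_eq_one hx
  refine ⟨G, hGs, fun x hx ↦ ?_, fun x hx ↦ ?_⟩
  · have e1 : G x - f x = ∑ i, χ i x * (F i x - f x) := by
      simp only [mul_sub, Finset.sum_sub_distrib, ← Finset.sum_mul, hsum x hx, hG]
      simp
    rw [e1]
    calc |∑ i, χ i x * (F i x - f x)| ≤ ∑ i, |χ i x * (F i x - f x)| :=
          Finset.abs_sum_le_sum_abs _ _
      _ ≤ ∑ i, χ i x * δ := by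
          refine Finset.sum_le_sum fun i _ ↦ ?_
          rw [abs_mul, abs_of_nonneg (χ.nonneg i x)]
          by_cases h0 : χ i x = 0
          · simp [h0]
          · exact mul_le_mul_of_nonneg_left (hF i x (hsupp i x h0)).1 (χ.nonneg i x)
      _ = δ := by rw [← Finset.sum_mul, hsum x hx, one_mul]
      _ ≤ ε := min_le_left _ _
  · have hxK : x ∈ K := interior_subset hx
    have hχd (i : t) : MDifferentiableAt (𝓡 n) 𝓘(ℝ, ℝ) (χ i) x :=
      (χ i).contMDiff.mdifferentiable (by simp) x
    have hFd (i : t) (hi : x ∈ tsupport (χ i)) : MDifferentiableAt (𝓡 n) 𝓘(ℝ, ℝ) (F i) x :=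
      ((hFs i).contMDiffAt ((hUo i).mem_nhds (hχ i hi))).mdifferentiableAt (by simp)
    have hmul (i : t) := differential_mul (hχd i) (hFd i)
    have hone : (∑ i, (χ i : M → ℝ)) =ᶠ[𝓝 x] fun _ ↦ 1 := by
      filter_upwards [mem_interior_iff_mem_nhds.1 hx] with y hy
      simpa using hsum y hy
    refine gradNorm_le_of_forall (by norm_num) fun v ↦ ?_
    have hzero : ∑ i, differential n (χ i) x v = 0 := by
      rw [← (differential_sum Finset.univ fun i _ ↦ hχd i).2 v, differential_congr hone,
        differential_const]
    have e1 : differential n G x v = ∑ i, χ i x * differential n (F i) x v +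
        ∑ i, (F i x - f x) * differential n (χ i) x v := by
      rw [hG, (differential_sum Finset.univ fun i _ ↦ (hmul i).1).2 v]
      simp only [(hmul _).2, sub_mul, Finset.sum_add_distrib, Finset.sum_sub_distrib,
        ← Finset.mul_sum, hzero, mul_zero, sub_zero]
    have hb1 : |∑ i, χ i x * differential n (F i) x v| ≤ 4 * ‖v‖ := by
      calc _ ≤ ∑ i, |χ i x * differential n (F i) x v| := Finset.abs_sum_le_sum_abs _ _
        _ ≤ ∑ i, χ i x * (4 * ‖v‖) := by
          refine Finset.sum_le_sum fun i _ ↦ ?_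
          rw [abs_mul, abs_of_nonneg (χ.nonneg i x)]
          by_cases h0 : χ i x = 0
          · simp [h0]
          · refine mul_le_mul_of_nonneg_left ((abs_differential_le _ _ _).trans ?_) (χ.nonneg i x)
            exact mul_le_mul_of_nonneg_right (hF i x (hsupp i x h0)).2 (norm_nonneg _)
        _ = 4 * ‖v‖ := by rw [← Finset.sum_mul, hsum x hxK, one_mul]
    have hb2 : |∑ i, (F i x - f x) * differential n (χ i) x v| ≤ ‖v‖ := by
      calc _ ≤ ∑ i, |(F i x - f x) * differential n (χ i) x v| := Finset.abs_sum_le_sum_abs _ _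
        _ ≤ ∑ i, δ * (C i * ‖v‖) := by
          refine Finset.sum_le_sum fun i _ ↦ ?_
          rw [abs_mul]
          by_cases h0 : x ∈ tsupport (χ i)
          · refine mul_le_mul (hF i x (hχ i h0)).1 ((abs_differential_le _ _ _).trans ?_)
              (abs_nonneg _) hδ.le
            exact mul_le_mul_of_nonneg_right (hC i x hxK) (norm_nonneg _)
          · rw [differential_congr (notMem_tsupport_iff_eventuallyEq.1 h0)]
            have := differential_const (n := n) 0 x v
            simp only [Pi.zero_def, this, abs_zero, mul_zero]
            have := hC0 i
            positivity
        _ = δ * D * ‖v‖ := by rw [← Finset.mul_sum, ← Finset.sum_mul, mul_assoc]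
        _ ≤ 1 * ‖v‖ := mul_le_mul_of_nonneg_right hδD (norm_nonneg _)
        _ = ‖v‖ := one_mul _
    rw [e1]
    exact (abs_add_le _ _).trans (by linarith)

end Smoothing

/-! ### Cutoff functions -/

section Cutoff

lemma exists_abs_deriv_smoothTransition_le : ∃ S : ℝ, ∀ t, |deriv Real.smoothTransition t| ≤ S := by
  have hc : Continuous fun t ↦ |deriv Real.smoothTransition t| :=
    ((Real.smoothTransition.contDiff (n := 1)).continuous_deriv le_rfl).abs
  obtain ⟨S, hS⟩ := (isCompact_Icc (a := (0 : ℝ)) (b := 1)).bddAbove_image hc.continuousOn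
  have hS' : ∀ t ∈ Icc (0 : ℝ) 1, |deriv Real.smoothTransition t| ≤ S := fun t ht ↦
    hS (mem_image_of_mem _ ht)
  have hS0 : 0 ≤ S := (abs_nonneg _).trans (hS' 0 (by simp))
  refine ⟨S, fun t ↦ ?_⟩
  rcases lt_or_ge t 0 with h | h
  · have : Real.smoothTransition =ᶠ[𝓝 t] fun _ ↦ 0 := by
      filter_upwards [Iio_mem_nhds h] with s hs
      exact Real.smoothTransition.zero_of_nonpos (le_of_lt hs)
    rw [this.deriv_eq]
    simpa using hS0
  rcases lt_or_ge 1 t with h' | h'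
  · have : Real.smoothTransition =ᶠ[𝓝 t] fun _ ↦ 1 := by
      filter_upwards [Ioi_mem_nhds h'] with s hs
      exact Real.smoothTransition.one_of_one_le (le_of_lt hs)
    rw [this.deriv_eq]
    simpa using hS0
  · exact hS' t ⟨h, h'⟩

variable {n : ℕ} {M : Type*} [MetricSpace M] [ChartedSpace (EuclideanSpace ℝ (Fin n)) M]
  [RiemannianBundle (fun x : M ↦ TangentSpace (𝓡 n) x)] [IsManifold (𝓡 n) ∞ M]
  [IsContinuousRiemannianBundle (EuclideanSpace ℝ (Fin n)) (fun x : M ↦ TangentSpace (𝓡 n) x)]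
  [IsRiemannianManifold (𝓡 n) M] [ProperSpace M]

variable (n) in
/-- Smooth cutoff functions between the concentric balls of radius `r / 2` and `r`, with gradient at
most a universal constant over `r`. -/
lemma exists_cutoff {S : ℝ} (hS : ∀ t, |deriv Real.smoothTransition t| ≤ S) (x : M) {r : ℝ}
    (hr : 0 < r) :
    ∃ φ : M → ℝ, ContMDiff (𝓡 n) 𝓘(ℝ, ℝ) ∞ φ ∧ HasCompactSupport φ ∧
      tsupport φ ⊆ Metric.ball x r ∧ (∀ y, 0 ≤ φ y ∧ φ y ≤ 1) ∧
      (∀ y ∈ Metric.ball x (r / 2), φ y = 1) ∧ ∀ y, gradNorm n φ y ≤ 20 * S / r := by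
  have hS0 : 0 ≤ S := (abs_nonneg _).trans (hS 0)
  have hcl := isCompact_closedBall x r
  obtain ⟨F, hFs, hF, hFg⟩ := exists_smoothing n (LipschitzWith.dist_right x) hcl
    (show 0 < r / 20 by positivity)
  -- `h` equals `1` up to `3 r / 5` and `0` from `9 r / 10` on; the margins absorb the error `r / 20`
  -- between `F` and the distance to `x`.
  set h : ℝ → ℝ := fun s ↦ Real.smoothTransition (3 - 10 / 3 * (s / r)) with hh
  have hhs : ContDiff ℝ ∞ h := Real.smoothTransition.contDiff.comp (by fun_prop)
  have hh' (s : ℝ) : |deriv h s| ≤ 4 * S / r := by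
    have h1 : HasDerivAt (fun s : ℝ ↦ 3 - 10 / 3 * (s / r)) (-(10 / 3 * (1 / r))) s :=
      (((hasDerivAt_id s).div_const r).const_mul (10 / 3)).const_sub 3
    have h2 := ((Real.smoothTransition.contDiff (n := 1)).differentiable one_ne_zero
      (3 - 10 / 3 * (s / r))).hasDerivAt.comp s h1
    have h3 : deriv h s = _ := h2.deriv
    rw [h3, abs_mul, abs_neg, abs_of_nonneg (show 0 ≤ 10 / 3 * (1 / r) by positivity)]
    calc _ ≤ S * (10 / 3 * (1 / r)) := mul_le_mul_of_nonneg_right (hS _) (by positivity)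
      _ = 10 / 3 * S / r := by ring
      _ ≤ 4 * S / r := by gcongr; norm_num
  -- `F` is controlled only on the ball, so the composition is cut off outside.
  set φ : M → ℝ := (Metric.ball x r).indicator (h ∘ F) with hφ
  have hφb {y : M} (hy : y ∈ Metric.ball x r) : φ y = h (F y) := indicator_of_mem hy _
  have hFy {y : M} (hy : y ∈ Metric.ball x r) := abs_le.1 (hF y (Metric.ball_subset_closedBall hy))
  have hsub : tsupport φ ⊆ Metric.closedBall x (19 / 20 * r) := by
    refine closure_minimal (fun y hy ↦ ?_) Metric.isClosed_closedBall
    by_contra hn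
    rw [Metric.mem_closedBall', not_le] at hn
    refine hy ?_
    by_cases hyb : y ∈ Metric.ball x r
    · rw [hφb hyb]
      refine Real.smoothTransition.zero_of_nonpos ?_
      have : 9 / 10 ≤ F y / r := by
        rw [le_div_iff₀ hr]; linarith [(hFy hyb).1]
      linarith
    · exact indicator_of_notMem hyb _
  have hsub' : tsupport φ ⊆ Metric.ball x r :=
    hsub.trans (Metric.closedBall_subset_ball (by linarith))
  have hev {y : M} (hy : y ∈ Metric.ball x r) : φ =ᶠ[𝓝 y] h ∘ F := by
    filter_upwards [Metric.isOpen_ball.mem_nhds hy] with w hw using hφb hw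
  refine ⟨φ, ?_, ?_, hsub', fun y ↦ ?_, fun y hy ↦ ?_, fun y ↦ ?_⟩
  · refine contMDiff_of_tsupport fun y hy ↦ ?_
    exact (hhs.contMDiff.comp hFs).contMDiffAt.congr_of_eventuallyEq (hev (hsub' hy))
  · exact (isCompact_closedBall x (19 / 20 * r)).of_isClosed_subset (isClosed_tsupport φ) hsub
  · by_cases hyb : y ∈ Metric.ball x r
    · rw [hφb hyb]
      exact ⟨Real.smoothTransition.nonneg _, Real.smoothTransition.le_one _⟩
    · rw [hφ, indicator_of_notMem hyb]
      simp
  · have hyb : y ∈ Metric.ball x r := Metric.ball_subset_ball (by linarith) hy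
    rw [hφb hyb]
    refine Real.smoothTransition.one_of_one_le ?_
    have : F y / r ≤ 11 / 20 := by
      rw [div_le_iff₀ hr]; linarith [(hFy hyb).2, Metric.mem_ball'.1 hy]
    linarith
  · by_cases hy : y ∈ tsupport φ
    · have hyb := hsub' hy
      rw [gradNorm_congr (hev hyb)]
      refine gradNorm_le_of_forall (by positivity) fun v ↦ ?_
      rw [differential_comp (hhs.differentiable (by simp) _) (hFs.mdifferentiable (by simp) _),
        abs_mul]
      have h5 : gradNorm n F y ≤ 5 := hFg y
        (interior_mono Metric.ball_subset_closedBall (by rwa [Metric.isOpen_ball.interior_eq]))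
      calc _ ≤ (4 * S / r) * (5 * ‖v‖) := by
            refine mul_le_mul (hh' _) ((abs_differential_le _ _ _).trans ?_) (abs_nonneg _)
              (by positivity)
            exact mul_le_mul_of_nonneg_right h5 (norm_nonneg _)
        _ = 20 * S / r * ‖v‖ := by ring
    · rw [gradNorm_congr (notMem_tsupport_iff_eventuallyEq.1 hy)]
      have := gradNorm_const (n := n) 0 y
      simp only [Pi.zero_def, this]
      positivity

end Cutoff

/-! ### Volume dichotomy from the Sobolev inequality -/

section Dichotomy

/-- The exponents are balanced: both terms on the left are at most a multiple of `ε r ^ (n - q)`,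
while the right-hand side is `ε ^ (1 - q / n) (r / 2) ^ (n - q)`, so a small `ε` suffices. -/
lemma sobolev_scaling_le {n q A C ε r s : ℝ} (hq : 1 ≤ q) (hqn : q ≤ n - 1) (hA : 0 < A)
    (hC : 1 ≤ C) (hε : 0 < ε) (hε1 : ε ≤ 1) (hεA : A * (C ^ n + 1) * 2 ^ n * ε ^ (1 / n) ≤ 1)
    (hr : 0 < r) (hs : s = (n - 1) / q) :
    A * ((C / r) ^ q * (ε * r ^ n) + (ε * r) ^ (1 / s) * (ε * r ^ n) ^ (1 - 1 / s)) ≤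
      (ε * (r / 2) ^ n) ^ ((n - q) / n) := by
  have hn : 0 < n := by linarith
  have hn1 : 0 < n - 1 := by linarith
  have hq0 : 0 < q := by linarith
  have hrn : 0 < r ^ n := by positivity
  have hs' : 1 / s = q / (n - 1) := by rw [hs, one_div_div]
  have e1 : (C / r) ^ q * (ε * r ^ n) = C ^ q * (ε * r ^ (n - q)) := by
    rw [Real.div_rpow (by linarith) hr.le, Real.rpow_sub hr]
    field_simp
  have e2 : (ε * r) ^ (1 / s) * (ε * r ^ n) ^ (1 - 1 / s) = ε * r ^ (n - q) := by
    rw [Real.mul_rpow hε.le hr.le, Real.mul_rpow hε.le hrn.le, ← Real.rpow_mul hr.le]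
    have a1 : ε ^ (1 / s) * ε ^ (1 - 1 / s) = ε := by
      rw [← Real.rpow_add hε]; simp
    have a2 : r ^ (1 / s) * r ^ (n * (1 - 1 / s)) = r ^ (n - q) := by
      rw [← Real.rpow_add hr, hs']
      congr 1
      field_simp
      ring
    calc _ = (ε ^ (1 / s) * ε ^ (1 - 1 / s)) * (r ^ (1 / s) * r ^ (n * (1 - 1 / s))) := by ring
      _ = _ := by rw [a1, a2]
  have e3 : (ε * (r / 2) ^ n) ^ ((n - q) / n) =
      ε ^ ((n - q) / n) * (r ^ (n - q) / 2 ^ (n - q)) := by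
    rw [Real.mul_rpow hε.le (by positivity), ← Real.rpow_mul (by positivity),
      mul_div_cancel₀ _ hn.ne', Real.div_rpow hr.le (by norm_num)]
  have e4 : ε = ε ^ ((n - q) / n) * ε ^ (q / n) := by
    rw [← Real.rpow_add hε, ← add_div, sub_add_cancel, div_self hn.ne', Real.rpow_one]
  have h1 : ε ^ (q / n) ≤ ε ^ (1 / n) :=
    Real.rpow_le_rpow_of_exponent_ge hε hε1 (by gcongr)
  have h2 : C ^ q ≤ C ^ n := Real.rpow_le_rpow_of_exponent_le hC (by linarith)
  have h3 : (2 : ℝ) ^ (n - q) ≤ 2 ^ n :=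
    Real.rpow_le_rpow_of_exponent_le (by norm_num) (by linarith)
  rw [e1, e2, e3]
  have h4 : A * (C ^ q + 1) * 2 ^ (n - q) * ε ^ (q / n) ≤ 1 := by
    refine le_trans ?_ hεA
    gcongr
  have h5 : A * (C ^ q + 1) * ε ^ (q / n) ≤ 1 / 2 ^ (n - q) := by
    rw [le_div_iff₀ (by positivity)]
    linarith
  calc A * (C ^ q * (ε * r ^ (n - q)) + ε * r ^ (n - q))
      = (A * (C ^ q + 1)) * ε * r ^ (n - q) := by ring
    _ = (A * (C ^ q + 1) * ε ^ (q / n)) * (ε ^ ((n - q) / n) * r ^ (n - q)) := by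
        nth_rewrite 1 [e4]; ring
    _ ≤ 1 / 2 ^ (n - q) * (ε ^ ((n - q) / n) * r ^ (n - q)) := by gcongr
    _ = _ := by ring

/-- Hölder's inequality against the constant function `1`. -/
lemma lintegral_le_rpow_lintegral_rpow {X : Type*} [MeasurableSpace X] {μ : Measure X} {σ : X → ℝ}
    (hσ : Measurable σ) (hσ0 : ∀ x, 0 ≤ σ x) {s : ℝ} (hs : 1 ≤ s) :
    ∫⁻ x, ENNReal.ofReal (σ x) ∂μ ≤
      (∫⁻ x, ENNReal.ofReal (σ x ^ s) ∂μ) ^ (1 / s) * μ univ ^ (1 - 1 / s) := by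
  have := eLpNorm'_le_eLpNorm'_mul_rpow_measure_univ (μ := μ) one_pos hs hσ.aestronglyMeasurable
  simp only [eLpNorm', ENNReal.rpow_one, div_one] at this
  convert this using 5 with x x
  · exact (Real.enorm_eq_ofReal (hσ0 _)).symm
  · rw [Real.enorm_eq_ofReal (hσ0 _), ENNReal.ofReal_rpow_of_nonneg (hσ0 _) (by linarith)]

variable {n : ℕ} {M : Type*} [MetricSpace M] [ChartedSpace (EuclideanSpace ℝ (Fin n)) M]
  [RiemannianBundle (fun x : M ↦ TangentSpace (𝓡 n) x)] [IsManifold (𝓡 n) ∞ M]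
  [IsContinuousRiemannianBundle (EuclideanSpace ℝ (Fin n)) (fun x : M ↦ TangentSpace (𝓡 n) x)]
  [IsRiemannianManifold (𝓡 n) M] [ProperSpace M] [MeasurableSpace M] [BorelSpace M]
  {q A S : ℝ} {σ : M → ℝ}

/-- The Sobolev inequality applied to a cutoff function compares the volumes of the balls of radius
`r / 2` and `r`. -/
lemma SobolevInequality.riemannianVolume_ball_half_le (hSob : SobolevInequality n q A σ)
    (hS : ∀ t, |deriv Real.smoothTransition t| ≤ S) (hq : 1 ≤ q) (hqn : q ≤ (n : ℝ) - 1)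
    (hσ0 : ∀ x, 0 ≤ σ x) (x : M) {r : ℝ} (hr : 0 < r) :
    riemannianVolume n M (Metric.ball x (r / 2)) ^ (((n : ℝ) - q) / n) ≤
      ENNReal.ofReal A * (ENNReal.ofReal ((20 * S / r) ^ q) *
        riemannianVolume n M (Metric.ball x r) +
        ∫⁻ y in Metric.ball x r, ENNReal.ofReal (σ y) ∂riemannianVolume n M) := by
  have hS0 : 0 ≤ S := (abs_nonneg _).trans (hS 0)
  have hq0 : 0 < q := by linarith
  have hn0 : (0 : ℝ) < n := by linarith
  have hnq : 0 < (n : ℝ) - q := by linarith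
  obtain ⟨φ, hφ, hφc, hφs, hφ01, hφ1, hφg⟩ := exists_cutoff n hS x hr
  set μ := riemannianVolume n M
  have h1 : μ (Metric.ball x (r / 2)) ≤
      ∫⁻ y, ENNReal.ofReal (|φ y| ^ (q * n / (n - q))) ∂μ := by
    rw [← setLIntegral_one]
    refine (setLIntegral_mono' measurableSet_ball fun y hy ↦ ?_).trans
      (setLIntegral_le_lintegral _ _)
    rw [hφ1 y hy]
    simp
  have h2 : ∫⁻ y, ENNReal.ofReal (gradNorm n φ y ^ q + σ y * |φ y| ^ q) ∂μ ≤
      ENNReal.ofReal ((20 * S / r) ^ q) * μ (Metric.ball x r) +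
        ∫⁻ y in Metric.ball x r, ENNReal.ofReal (σ y) ∂μ := by
    rw [← setLIntegral_const, ← lintegral_add_left measurable_const,
      ← lintegral_indicator measurableSet_ball]
    refine lintegral_mono fun y ↦ ?_
    by_cases hy : y ∈ Metric.ball x r
    · rw [indicator_of_mem hy, ← ENNReal.ofReal_add (by positivity) (hσ0 y)]
      refine ENNReal.ofReal_le_ofReal (add_le_add ?_ ?_)
      · exact Real.rpow_le_rpow (gradNorm_nonneg _ _) (hφg y) hq0.le
      · refine mul_le_of_le_one_right (hσ0 y) (Real.rpow_le_one (abs_nonneg _) ?_ hq0.le)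
        rw [abs_of_nonneg (hφ01 y).1]
        exact (hφ01 y).2
    · have hy' : y ∉ tsupport φ := fun h ↦ hy (hφs h)
      have hg : gradNorm n φ y = 0 := by
        rw [gradNorm_congr (notMem_tsupport_iff_eventuallyEq.1 hy')]
        exact gradNorm_const 0 y
      rw [hg, image_eq_zero_of_notMem_tsupport hy', abs_zero, Real.zero_rpow hq0.ne']
      simp
  calc _ ≤ (∫⁻ y, ENNReal.ofReal (|φ y| ^ (q * n / (n - q))) ∂μ) ^ (((n : ℝ) - q) / n) :=
        ENNReal.rpow_le_rpow h1 (by positivity)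
    _ ≤ _ := hSob φ hφ hφc
    _ ≤ _ := by gcongr

/-- **Decay of small volumes.** If the ball of radius `r` has volume at most `ε rⁿ` and carries
little potential, then the ball of radius `r / 2` satisfies the same volume bound. -/
lemma SobolevInequality.riemannianVolume_ball_half_le_of_le (hSob : SobolevInequality n q A σ)
    (hS : ∀ t, |deriv Real.smoothTransition t| ≤ S) (hS1 : 1 ≤ 20 * S)
    (hq : 1 ≤ q) (hqn : q ≤ (n : ℝ) - 1) (hA : 0 < A)
    (hσ : Continuous σ) (hσ0 : ∀ x, 0 ≤ σ x) {ε : ℝ} (hε : 0 < ε) (hε1 : ε ≤ 1)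
    (hεA : A * ((20 * S) ^ (n : ℝ) + 1) * 2 ^ (n : ℝ) * ε ^ (1 / (n : ℝ)) ≤ 1)
    (x : M) {r : ℝ} (hr : 0 < r)
    (hV : riemannianVolume n M (Metric.ball x r) ≤ ENNReal.ofReal (ε * r ^ n))
    (hI : ∫⁻ y in Metric.ball x r, ENNReal.ofReal (σ y ^ (((n : ℝ) - 1) / q))
      ∂riemannianVolume n M ≤ ENNReal.ofReal (ε * r)) :
    riemannianVolume n M (Metric.ball x (r / 2)) ≤ ENNReal.ofReal (ε * (r / 2) ^ n) := by
  have hq0 : 0 < q := by linarith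
  have hn0 : (0 : ℝ) < n := by linarith
  have hnq : 0 < (n : ℝ) - q := by linarith
  have hs1 : 1 ≤ ((n : ℝ) - 1) / q := by rwa [le_div_iff₀ hq0, one_mul]
  have hs' : 1 / (((n : ℝ) - 1) / q) ≤ 1 := by
    rw [div_le_one (by linarith)]; exact hs1
  have hs0 : 0 ≤ 1 / (((n : ℝ) - 1) / q) := by positivity
  have h1 := hSob.riemannianVolume_ball_half_le hS hq hqn hσ0 x hr
  have h2 := lintegral_le_rpow_lintegral_rpow (μ := (riemannianVolume n M).restrict
    (Metric.ball x r)) hσ.measurable hσ0 hs1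
  rw [Measure.restrict_apply_univ] at h2
  rw [← ENNReal.rpow_le_rpow_iff (show 0 < ((n : ℝ) - q) / n by positivity),
    ENNReal.ofReal_rpow_of_nonneg (by positivity) (by positivity)]
  have h3 := sobolev_scaling_le hq hqn hA hS1 hε hε1 hεA hr rfl
  simp only [Real.rpow_natCast] at h3
  refine le_trans ?_ (ENNReal.ofReal_le_ofReal h3)
  rw [ENNReal.ofReal_mul hA.le, ENNReal.ofReal_add (by positivity) (by positivity),
    ENNReal.ofReal_mul (p := (20 * S / r) ^ q) (by positivity),
    ENNReal.ofReal_mul (p := (ε * r) ^ (1 / (((n : ℝ) - 1) / q))) (by positivity),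
    ← ENNReal.ofReal_rpow_of_nonneg (x := ε * r) (by positivity) hs0,
    ← ENNReal.ofReal_rpow_of_nonneg (x := ε * r ^ n) (by positivity) (by linarith)]
  refine h1.trans ?_
  gcongr
  refine h2.trans ?_
  gcongr

/-- **Volume dichotomy.** With a constant `ε` that depends only on `n` and `A`, a ball of radius
`R` on which the potential is small at all scales has volume at least `ε Rⁿ`: otherwise the volume
ratio would stay below `ε` at all the scales `R / 2ᵏ`, contradicting the
lower bound on it at small scales. -/
lemma SobolevInequality.lt_riemannianVolume_ball (hSob : SobolevInequality n q A σ)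
    (hS : ∀ t, |deriv Real.smoothTransition t| ≤ S) (hS1 : 1 ≤ 20 * S)
    (hq : 1 ≤ q) (hqn : q ≤ (n : ℝ) - 1) (hA : 0 < A)
    (hσ : Continuous σ) (hσ0 : ∀ x, 0 ≤ σ x) {ε : ℝ} (hε : 0 < ε) (hε1 : ε ≤ 1)
    (hεA : A * ((20 * S) ^ (n : ℝ) + 1) * 2 ^ (n : ℝ) * ε ^ (1 / (n : ℝ)) ≤ 1)
    (hεV : ENNReal.ofReal (ε * 4 ^ n) < volume (Metric.ball (0 : EuclideanSpace ℝ (Fin n)) 1))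
    (x : M) {R : ℝ} (hR : 0 < R)
    (hI : ∀ r, 0 < r → r ≤ R → ∫⁻ y in Metric.ball x r,
      ENNReal.ofReal (σ y ^ (((n : ℝ) - 1) / q)) ∂riemannianVolume n M ≤ ENNReal.ofReal (ε * r)) :
    ENNReal.ofReal (ε * R ^ n) < riemannianVolume n M (Metric.ball x R) := by
  by_contra hV
  rw [not_lt] at hV
  have key : ∀ k : ℕ, riemannianVolume n M (Metric.ball x (R / 2 ^ k)) ≤
      ENNReal.ofReal (ε * (R / 2 ^ k) ^ n) := fun k ↦ by
    induction k with
    | zero => simpa using hV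
    | succ k ih =>
      have hpow : (1 : ℝ) ≤ 2 ^ k := one_le_pow₀ (by norm_num)
      have := hSob.riemannianVolume_ball_half_le_of_le hS hS1 hq hqn hA hσ hσ0 hε hε1 hεA x
        (show 0 < R / 2 ^ k by positivity) ih
        (hI _ (by positivity) (div_le_self hR.le hpow))
      rwa [div_div, ← pow_succ] at this
  obtain ⟨r₀, hr₀, hvol⟩ := exists_le_riemannianVolume_ball (n := n) x
  obtain ⟨k, hk⟩ := exists_pow_lt_of_lt_one (div_pos hr₀ hR) (show (1 / 2 : ℝ) < 1 by norm_num)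
  set r := R / 2 ^ k with hr
  have hr0 : 0 < r := by positivity
  have hrr : r ≤ r₀ := by
    rw [lt_div_iff₀ hR, one_div, inv_pow] at hk
    rw [hr, div_eq_inv_mul]
    exact hk.le
  have h1 := key k
  rw [← hr] at h1
  replace h1 := (hvol r hr0 hrr).trans h1
  have h2 : ENNReal.ofReal (ε * r ^ n) = ENNReal.ofReal ((r / 4) ^ n) *
      ENNReal.ofReal (ε * 4 ^ n) := by
    have h3 : (r / 4) ^ n * 4 ^ n = r ^ n := by rw [← mul_pow, div_mul_cancel₀ _ four_ne_zero]
    rw [← ENNReal.ofReal_mul (by positivity), ← h3]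
    congr 1
    ring
  rw [h2, ENNReal.mul_le_mul_iff_right (ENNReal.ofReal_pos.2 (by positivity)).ne' ENNReal.ofReal_ne_top] at h1
  exact absurd h1 (not_le.2 hεV)

end Dichotomy

/-! ### Volume and potential carried by an end -/

section Ends

variable {n : ℕ} {M : Type*} [MetricSpace M]

lemma exists_dist_eq_of_mem_endsWithRespectTo {Ω E : Set M} (hE : E ∈ endsWithRespectTo Ω)
    {p x₀ : M} (hx₀ : x₀ ∈ E) {t : ℝ} (ht : dist p x₀ ≤ t) : ∃ x ∈ E, dist p x = t := by
  obtain ⟨⟨x, hx, rfl⟩, hunb⟩ := hE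
  obtain ⟨y, hy, hty⟩ : ∃ y ∈ connectedComponentIn Ωᶜ x, t < dist p y := by
    by_contra! h
    exact hunb ((Metric.isBounded_closedBall (x := p) (r := t)).subset fun y hy ↦
      Metric.mem_closedBall'.2 (h y hy))
  obtain ⟨z, hz, hzt⟩ := isPreconnected_connectedComponentIn.intermediate_value hx₀ hy
    (f := fun y ↦ dist p y) (by fun_prop) ⟨ht, hty.le⟩
  exact ⟨z, hz, hzt⟩

lemma subset_of_mem_endsWithRespectTo {Ω E B : Set M} (hE : E ∈ endsWithRespectTo Ω)
    (hB : IsPreconnected B) (hBΩ : B ⊆ Ωᶜ) {x : M} (hxE : x ∈ E) (hxB : x ∈ B) : B ⊆ E := by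
  obtain ⟨⟨y, hy, rfl⟩, -⟩ := hE
  rw [connectedComponentIn_eq hxE]
  exact hB.subset_connectedComponentIn hxB hBΩ

lemma disjoint_of_mem_endsWithRespectTo {Ω E E' : Set M} (hE : E ∈ endsWithRespectTo Ω)
    (hE' : E' ∈ endsWithRespectTo Ω) (h : E ≠ E') : Disjoint E E' := by
  obtain ⟨⟨y, hy, rfl⟩, -⟩ := hE
  obtain ⟨⟨y', hy', rfl⟩, -⟩ := hE'
  rw [Set.disjoint_left]
  intro x hx hx'
  exact h ((connectedComponentIn_eq hx).trans (connectedComponentIn_eq hx').symm)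

variable [MeasurableSpace M] [BorelSpace M]

/-- A Vitali covering argument along the radial direction. If for every `t ∈ [R, 2R]` there is a
ball centred on the sphere of radius `t` around `p`, contained in `T`, whose `ν`-measure is at least
`c` times its radius, then `T` has `ν`-measure at least `c R / 10`. -/
lemma ofReal_le_measure_of_radial_cover {ν : Measure M} {T : Set M} {p : M} {R c : ℝ}
    (hc : 0 < c) (x : ℝ → M) (ρ : ℝ → ℝ) (hx : ∀ t ∈ Icc R (2 * R), dist p (x t) = t)
    (hρ : ∀ t ∈ Icc R (2 * R), 0 < ρ t ∧ ρ t ≤ R)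
    (hT : ∀ t ∈ Icc R (2 * R), Metric.ball (x t) (ρ t) ⊆ T)
    (hν : ∀ t ∈ Icc R (2 * R), ENNReal.ofReal (c * ρ t) ≤ ν (Metric.ball (x t) (ρ t))) :
    ENNReal.ofReal (c * R / 10) ≤ ν T := by
  obtain ⟨u, hut, hud, hu⟩ := Vitali.exists_disjoint_subfamily_covering_enlargement_closedBall
    (Icc R (2 * R)) (fun t : ℝ ↦ t) ρ R (fun t ht ↦ (hρ t ht).2) 5 (by norm_num)
  have hcount : u.Countable := hud.countable_of_nonempty_interior fun t ht ↦ by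
    refine ⟨t, ?_⟩
    exact Metric.ball_subset_interior_closedBall (Metric.mem_ball_self (hρ t (hut ht)).1)
  have : Countable u := hcount.to_subtype
  -- The intervals with the same centres and `5` times the radii cover `[R, 2R]`.
  have h1 : ENNReal.ofReal R ≤ ∑' t : u, ENNReal.ofReal (10 * ρ t) := by
    calc ENNReal.ofReal R = volume (Icc R (2 * R)) := by
          rw [Real.volume_Icc]; congr 1; ring
      _ ≤ volume (⋃ t : u, Metric.closedBall (t : ℝ) (5 * ρ t)) := by
          refine measure_mono fun t ht ↦ ?_
          obtain ⟨b, hb, hsub⟩ := hu t ht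
          exact mem_iUnion.2 ⟨⟨b, hb⟩, hsub (Metric.mem_closedBall_self (hρ t ht).1.le)⟩
      _ ≤ ∑' t : u, volume (Metric.closedBall (t : ℝ) (5 * ρ t)) := measure_iUnion_le _
      _ = ∑' t : u, ENNReal.ofReal (10 * ρ t) := by
          refine tsum_congr fun t ↦ ?_
          rw [Real.volume_closedBall]
          congr 1
          ring
  -- `dist p` is `1`-Lipschitz, so balls over disjoint intervals are disjoint.
  have hdisj : Pairwise (Function.onFun Disjoint fun t : u ↦ Metric.ball (x t) (ρ t)) := by
    intro a b hab
    refine Set.disjoint_left.2 fun y hya hyb ↦ ?_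
    have key : ∀ t : u, y ∈ Metric.ball (x t) (ρ t) →
        dist p y ∈ Metric.closedBall (t : ℝ) (ρ t) := fun t hy ↦ by
      have h2 := (abs_dist_sub_le y (x t) p).trans (Metric.mem_ball.1 hy).le
      rwa [dist_comm y, dist_comm (x t), hx t (hut t.2)] at h2
    exact Set.disjoint_left.1 (hud a.2 b.2 (Subtype.coe_injective.ne hab)) (key a hya) (key b hyb)
  calc ENNReal.ofReal (c * R / 10) = ENNReal.ofReal (c / 10) * ENNReal.ofReal R := by
        rw [← ENNReal.ofReal_mul (by positivity)]; congr 1; ring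
    _ ≤ ENNReal.ofReal (c / 10) * ∑' t : u, ENNReal.ofReal (10 * ρ t) := by gcongr
    _ = ∑' t : u, ENNReal.ofReal (c * ρ t) := by
        rw [← ENNReal.tsum_mul_left]
        refine tsum_congr fun t ↦ ?_
        rw [← ENNReal.ofReal_mul (by positivity)]; congr 1; ring
    _ ≤ ∑' t : u, ν (Metric.ball (x t) (ρ t)) := ENNReal.tsum_le_tsum fun t ↦ hν t (hut t.2)
    _ = ν (⋃ t : u, Metric.ball (x t) (ρ t)) :=
        (measure_iUnion hdisj fun t ↦ measurableSet_ball).symm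
    _ ≤ ν T := measure_mono (iUnion_subset fun t ↦ hT t (hut t.2))

variable [ChartedSpace (EuclideanSpace ℝ (Fin n)) M]
  [RiemannianBundle (fun x : M ↦ TangentSpace (𝓡 n) x)] [IsManifold (𝓡 n) ∞ M]
  [IsContinuousRiemannianBundle (EuclideanSpace ℝ (Fin n)) (fun x : M ↦ TangentSpace (𝓡 n) x)]
  [IsRiemannianManifold (𝓡 n) M] [ProperSpace M]
  {q A S : ℝ} {σ : M → ℝ}

/-- Every end carries, between the radii `R / 2` and `3 R`, a definite amount of volume or of
potential. -/
lemma SobolevInequality.volume_or_potential_of_end (hSob : SobolevInequality n q A σ)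
    (hS : ∀ t, |deriv Real.smoothTransition t| ≤ S) (hS1 : 1 ≤ 20 * S)
    (hq : 1 ≤ q) (hqn : q ≤ (n : ℝ) - 1) (hA : 0 < A)
    (hσ : Continuous σ) (hσ0 : ∀ x, 0 ≤ σ x) {ε : ℝ} (hε : 0 < ε) (hε1 : ε ≤ 1)
    (hεA : A * ((20 * S) ^ (n : ℝ) + 1) * 2 ^ (n : ℝ) * ε ^ (1 / (n : ℝ)) ≤ 1)
    (hεV : ENNReal.ofReal (ε * 4 ^ n) < volume (Metric.ball (0 : EuclideanSpace ℝ (Fin n)) 1))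
    {Ω E : Set M} (hE : E ∈ endsWithRespectTo Ω) (hEm : MeasurableSet E)
    {p x₀ : M} (hx₀ : x₀ ∈ E) {R : ℝ} (hR : 0 < R)
    (hx₀R : dist p x₀ ≤ R) (hΩ : Ω ⊆ Metric.closedBall p (R / 2)) :
    ENNReal.ofReal (ε * (R / 2) ^ n) ≤ riemannianVolume n M (E ∩ Metric.ball p (3 * R)) ∨
    ENNReal.ofReal (ε * R / 10) ≤
      ∫⁻ y in E ∩ (Metric.ball p (3 * R) \ Metric.closedBall p (R / 2)),
        ENNReal.ofReal (σ y ^ (((n : ℝ) - 1) / q)) ∂riemannianVolume n M := by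
  set μ := riemannianVolume n M
  set ν := μ.withDensity fun y ↦ ENNReal.ofReal (σ y ^ (((n : ℝ) - 1) / q)) with hν
  have hνball (x : M) (ρ : ℝ) : ν (Metric.ball x ρ) =
      ∫⁻ y in Metric.ball x ρ, ENNReal.ofReal (σ y ^ (((n : ℝ) - 1) / q)) ∂μ :=
    withDensity_apply _ measurableSet_ball
  have hball : ∀ x ∈ E, R ≤ dist p x → dist p x ≤ 2 * R → ∀ ρ, 0 < ρ → ρ ≤ R / 2 →
      Metric.ball x ρ ⊆ E ∩ (Metric.ball p (3 * R) \ Metric.closedBall p (R / 2)) := by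
    intro x hx h1 h2 ρ hρ0 hρ
    have hann : Metric.ball x ρ ⊆ Metric.ball p (3 * R) \ Metric.closedBall p (R / 2) := by
      intro y hy
      have h3 := Metric.mem_ball'.1 hy
      refine ⟨Metric.mem_ball'.2 ?_, fun h ↦ ?_⟩
      · linarith [dist_triangle p x y]
      · linarith [Metric.mem_closedBall'.1 h, dist_triangle p y x, dist_comm x y]
    exact subset_inter (subset_of_mem_endsWithRespectTo hE (isPreconnected_ball n x ρ)
      (fun y hy hyΩ ↦ (hann hy).2 (hΩ hyΩ)) hx (Metric.mem_ball_self hρ0)) hann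
  by_cases hbig : ∃ x ∈ E, R ≤ dist p x ∧ dist p x ≤ 2 * R ∧
      ENNReal.ofReal (ε * (R / 2) ^ n) < μ (Metric.ball x (R / 2))
  · obtain ⟨x, hx, h1, h2, h3⟩ := hbig
    exact Or.inl (h3.le.trans (measure_mono ((hball x hx h1 h2 _ (by positivity) le_rfl).trans
      (inter_subset_inter_right _ sdiff_subset))))
  · refine Or.inr ?_
    have hex : ∀ t : ℝ, ∃ (x : M) (ρ : ℝ), t ∈ Icc R (2 * R) → x ∈ E ∧ dist p x = t ∧ 0 < ρ ∧
        ρ ≤ R / 2 ∧ ENNReal.ofReal (ε * ρ) < ν (Metric.ball x ρ) := by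
      intro t
      by_cases ht : t ∈ Icc R (2 * R)
      · obtain ⟨x, hx, hxt⟩ := exists_dist_eq_of_mem_endsWithRespectTo hE hx₀ (hx₀R.trans ht.1)
        by_contra! hcon
        refine hbig ⟨x, hx, hxt ▸ ht.1, hxt ▸ ht.2, ?_⟩
        refine hSob.lt_riemannianVolume_ball hS hS1 hq hqn hA hσ hσ0 hε hε1 hεA hεV x
          (by positivity) fun ρ hρ0 hρ ↦ ?_
        rw [← hνball]
        exact (hcon x ρ).2 hx hxt hρ0 hρ
      · exact ⟨p, 0, fun h ↦ absurd h ht⟩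
    choose x ρ hxρ using hex
    have hann (t) (ht : t ∈ Icc R (2 * R)) := hball (x t) (hxρ t ht).1
      (by rw [(hxρ t ht).2.1]; exact ht.1) (by rw [(hxρ t ht).2.1]; exact ht.2) (ρ t)
      (hxρ t ht).2.2.1 (hxρ t ht).2.2.2.1
    have := ofReal_le_measure_of_radial_cover (ν := ν) hε x ρ (fun t ht ↦ (hxρ t ht).2.1)
      (fun t ht ↦ ⟨(hxρ t ht).2.2.1, (hxρ t ht).2.2.2.1.trans (by linarith)⟩)
      hann (fun t ht ↦ (hxρ t ht).2.2.2.2.le)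
    rwa [hν, withDensity_apply _
      (hEm.inter (measurableSet_ball.diff measurableSet_closedBall))] at this

/-- The cardinality of a finite family of ends, bounded by comparing the total volume and weighted
potential of the ball of radius `3 R` with the amount carried by each end. -/
lemma SobolevInequality.card_mul_le (hSob : SobolevInequality n q A σ)
    (hS : ∀ t, |deriv Real.smoothTransition t| ≤ S) (hS1 : 1 ≤ 20 * S)
    (hq : 1 ≤ q) (hqn : q ≤ (n : ℝ) - 1) (hA : 0 < A)
    (hσ : Continuous σ) (hσ0 : ∀ x, 0 ≤ σ x) {ε : ℝ} (hε : 0 < ε) (hε1 : ε ≤ 1)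
    (hεA : A * ((20 * S) ^ (n : ℝ) + 1) * 2 ^ (n : ℝ) * ε ^ (1 / (n : ℝ)) ≤ 1)
    (hεV : ENNReal.ofReal (ε * 4 ^ n) < volume (Metric.ball (0 : EuclideanSpace ℝ (Fin n)) 1))
    {Ω : Set M} (hΩc : IsClosed Ω) (F : Finset (Set M)) (hF : ∀ E ∈ F, E ∈ endsWithRespectTo Ω)
    {p : M} {R : ℝ} (hR : 0 < R) (hFR : ∀ E ∈ F, ∃ x ∈ E, dist p x ≤ R)
    (hΩ : Ω ⊆ Metric.closedBall p (R / 2)) :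
    F.card * ENNReal.ofReal (ε * (R / 2) ^ n / 5) ≤ ballVolume n p (3 * R) +
      ∫⁻ y in Metric.ball p (3 * R), ENNReal.ofReal ((dist p y ^ q * σ y) ^ (((n : ℝ) - 1) / q))
        ∂riemannianVolume n M := by
  have : LocallyConnectedSpace M := ChartedSpace.locallyConnectedSpace (EuclideanSpace ℝ (Fin n)) M
  have hq0 : 0 < q := by linarith
  have hn0 : 1 < n := by
    have : (1 : ℝ) < n := by linarith
    exact_mod_cast this
  set μ := riemannianVolume n M
  set B := Metric.ball p (3 * R)
  set s : ℝ := ((n : ℝ) - 1) / q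
  set ν := μ.restrict B +
    (μ.restrict B).withDensity (fun y ↦ ENNReal.ofReal ((dist p y ^ q * σ y) ^ s)) with hν
  have hEm : ∀ E ∈ F, MeasurableSet E := fun E hE ↦ by
    obtain ⟨⟨x, hx, rfl⟩, -⟩ := hF E hE
    exact hΩc.isOpen_compl.connectedComponentIn.measurableSet
  have hEν : ∀ E ∈ F, ENNReal.ofReal (ε * (R / 2) ^ n / 5) ≤ ν E := fun E hE ↦ by
    obtain ⟨x₀, hx₀, hx₀R⟩ := hFR E hE
    have hνE : ν E = μ (E ∩ B) + ∫⁻ y in E ∩ B, ENNReal.ofReal ((dist p y ^ q * σ y) ^ s) ∂μ := by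
      rw [hν, Measure.add_apply, withDensity_apply _ (hEm E hE), Measure.restrict_apply (hEm E hE),
        Measure.restrict_restrict (hEm E hE)]
    rw [hνE]
    rcases hSob.volume_or_potential_of_end hS hS1 hq hqn hA hσ hσ0 hε hε1 hεA hεV (hF E hE)
      (hEm E hE) hx₀ hR hx₀R hΩ with h | h
    · refine le_trans (ENNReal.ofReal_le_ofReal ?_) (h.trans le_self_add)
      have : 0 < ε * (R / 2) ^ n := by positivity
      linarith
    · refine le_trans ?_ le_add_self
      have hTm : MeasurableSet (E ∩ (B \ Metric.closedBall p (R / 2))) :=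
        (hEm E hE).inter (measurableSet_ball.diff measurableSet_closedBall)
      calc ENNReal.ofReal (ε * (R / 2) ^ n / 5)
          = ENNReal.ofReal ((R / 2) ^ (n - 1)) * ENNReal.ofReal (ε * R / 10) := by
            rw [← ENNReal.ofReal_mul (by positivity)]
            congr 1
            obtain ⟨m, rfl⟩ : ∃ m, n = m + 1 := ⟨n - 1, by omega⟩
            rw [Nat.add_sub_cancel, pow_succ]
            ring
        _ ≤ ENNReal.ofReal ((R / 2) ^ (n - 1)) * ∫⁻ y in E ∩ (B \ Metric.closedBall p (R / 2)),
              ENNReal.ofReal (σ y ^ s) ∂μ := by gcongr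
        _ = ∫⁻ y in E ∩ (B \ Metric.closedBall p (R / 2)),
              ENNReal.ofReal ((R / 2) ^ (n - 1)) * ENNReal.ofReal (σ y ^ s) ∂μ :=
            (lintegral_const_mul _ (hσ.measurable.pow_const _).ennreal_ofReal).symm
        _ ≤ ∫⁻ y in E ∩ (B \ Metric.closedBall p (R / 2)),
              ENNReal.ofReal ((dist p y ^ q * σ y) ^ s) ∂μ := by
            refine setLIntegral_mono' hTm fun y hy ↦ ?_
            rw [← ENNReal.ofReal_mul (by positivity)]
            refine ENNReal.ofReal_le_ofReal ?_
            -- Away from `B_p(R / 2)` the weight `r ^ (q s) = r ^ (n - 1)` is at least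
            -- `(R / 2) ^ (n - 1)`.
            have hd : R / 2 ≤ dist p y := by
              by_contra hcon
              exact hy.2.2 (Metric.mem_closedBall'.2 (not_le.1 hcon).le)
            have hs : q * s = ((n - 1 : ℕ) : ℝ) := by
              rw [Nat.cast_sub hn0.le, Nat.cast_one]
              exact mul_div_cancel₀ _ hq0.ne'
            rw [Real.mul_rpow (by positivity) (hσ0 y), ← Real.rpow_mul dist_nonneg, hs,
              Real.rpow_natCast]
            have := hσ0 y
            gcongr
        _ ≤ _ := lintegral_mono_set (inter_subset_inter_right _ sdiff_subset)
  calc (F.card : ℝ≥0∞) * ENNReal.ofReal (ε * (R / 2) ^ n / 5)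
      = ∑ E ∈ F, ENNReal.ofReal (ε * (R / 2) ^ n / 5) := by simp
    _ ≤ ∑ E ∈ F, ν E := Finset.sum_le_sum hEν
    _ = ν (⋃ E ∈ F, E) := (measure_biUnion_finset (fun E hE E' hE' h ↦
        disjoint_of_mem_endsWithRespectTo (hF E hE) (hF E' hE') h) hEm).symm
    _ ≤ ν univ := measure_mono (subset_univ _)
    _ = _ := by
      rw [hν, Measure.add_apply, withDensity_apply _ MeasurableSet.univ, Measure.restrict_univ,
        Measure.restrict_apply_univ]
      rfl

end Ends

/-! ### Counting the ends -/

section Ends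

/-- The threshold of the volume dichotomy can be chosen as a function of `n` and `A` only. -/
lemma exists_volume_threshold {n : ℕ} (hn : 0 < n) (A S : ℝ) : ∃ ε : ℝ, 0 < ε ∧ ε ≤ 1 ∧
    A * ((20 * S) ^ (n : ℝ) + 1) * 2 ^ (n : ℝ) * ε ^ (1 / (n : ℝ)) ≤ 1 ∧
    ENNReal.ofReal (ε * 4 ^ n) < volume (Metric.ball (0 : EuclideanSpace ℝ (Fin n)) 1) := by
  have hn' : (0 : ℝ) < n := by exact_mod_cast hn
  have h1 : Tendsto (fun ε : ℝ ↦
      A * ((20 * S) ^ (n : ℝ) + 1) * 2 ^ (n : ℝ) * ε ^ (1 / (n : ℝ))) (𝓝[>] 0) (𝓝 0) := by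
    have h := (Real.continuousAt_rpow_const 0 (1 / (n : ℝ))
      (Or.inr (by positivity))).tendsto.const_mul (A * ((20 * S) ^ (n : ℝ) + 1) * 2 ^ (n : ℝ))
    rw [Real.zero_rpow (by positivity), mul_zero] at h
    exact h.mono_left nhdsWithin_le_nhds
  have h2 : Tendsto (fun ε : ℝ ↦ ENNReal.ofReal (ε * 4 ^ n)) (𝓝[>] 0) (𝓝 0) := by
    have h : Continuous fun ε : ℝ ↦ ENNReal.ofReal (ε * 4 ^ n) :=
      ENNReal.continuous_ofReal.comp (continuous_id.mul continuous_const)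
    exact (h.tendsto' 0 0 (by simp)).mono_left nhdsWithin_le_nhds
  have h3 : ∀ᶠ ε : ℝ in 𝓝[>] 0, ε ≤ 1 :=
    nhdsWithin_le_nhds (Iic_mem_nhds one_pos)
  obtain ⟨ε, ⟨⟨e1, e2⟩, e3⟩, e4⟩ := (((h1.eventually_le_const one_pos).and (h2.eventually_lt_const
    (Metric.measure_ball_pos volume (0 : EuclideanSpace ℝ (Fin n)) one_pos))).and h3).and
      self_mem_nhdsWithin |>.exists
  exact ⟨ε, e4, e3, e1, e2⟩

variable {n : ℕ} {M : Type*} [MetricSpace M] [MeasurableSpace M]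
  [ChartedSpace (EuclideanSpace ℝ (Fin n)) M]
  [RiemannianBundle (fun x : M ↦ TangentSpace (𝓡 n) x)]

/-- For large `R`, the volume and the weighted potential of the ball of radius `R` are controlled
by the two asymptotic quantities. -/
lemma eventually_ballVolume_add_potential_le {q : ℝ} {σ : M → ℝ} {p : M} {α Vinf : ℝ≥0}
    (hα : asymptoticPotential n p q σ = α) (hV : asymptoticVolumeRatio n p = Vinf) :
    ∀ᶠ R : ℝ in atTop, ballVolume n p R +
      ∫⁻ y in Metric.ball p R, ENNReal.ofReal ((dist p y ^ q * σ y) ^ (((n : ℝ) - 1) / q))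
        ∂riemannianVolume n M ≤ ENNReal.ofReal ((α + 2) * (Vinf + 1) * R ^ n) := by
  have h1 := eventually_lt_of_limsup_lt (show asymptoticPotential n p q σ < (α + 1 : ℝ≥0) by
    rw [hα]; exact_mod_cast lt_add_one α)
  have h2 := eventually_lt_of_limsup_lt (show asymptoticVolumeRatio n p < (Vinf + 1 : ℝ≥0) by
    rw [hV]; exact_mod_cast lt_add_one Vinf)
  filter_upwards [h1, h2, eventually_gt_atTop 0] with R hR1 hR2 hR
  set V := ballVolume n p R
  set I := ∫⁻ y in Metric.ball p R, ENNReal.ofReal ((dist p y ^ q * σ y) ^ (((n : ℝ) - 1) / q))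
        ∂riemannianVolume n M with hI
  have hRn : 0 < R ^ n := by positivity
  have hVle : V ≤ ENNReal.ofReal ((Vinf + 1) * R ^ n) := by
    rw [ENNReal.ofReal_mul (by positivity)]
    rw [ENNReal.div_lt_iff (Or.inl (ENNReal.ofReal_pos.2 hRn).ne')
      (Or.inl ENNReal.ofReal_ne_top)] at hR2
    refine hR2.le.trans_eq (congrArg (· * _) ?_)
    exact (ENNReal.ofReal_coe_nnreal (p := Vinf + 1)).symm
  have hVtop : V ≠ ⊤ := (hVle.trans_lt ENNReal.ofReal_lt_top).ne
  have hIle : I ≤ (α + 1 : ℝ≥0) * V := by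
    by_cases h0 : V = 0
    · have : (riemannianVolume n M).restrict (Metric.ball p R) = 0 :=
        Measure.restrict_eq_zero.2 h0
      rw [hI, this, lintegral_zero_measure]
      exact zero_le
    · rw [← ENNReal.div_le_iff h0 hVtop, ENNReal.div_eq_inv_mul]
      exact hR1.le
  calc V + I ≤ V + (α + 1 : ℝ≥0) * V := by gcongr
    _ = (α + 2 : ℝ≥0) * V := by push_cast; ring
    _ ≤ (α + 2 : ℝ≥0) * ENNReal.ofReal ((Vinf + 1) * R ^ n) := by gcongr
    _ = ENNReal.ofReal ((α + 2) * (Vinf + 1) * R ^ n) := by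
      rw [mul_assoc, ENNReal.ofReal_mul (p := (α : ℝ) + 2) (by positivity)]
      exact congrArg (· * _) (ENNReal.ofReal_coe_nnreal (p := α + 2)).symm

variable [BorelSpace M] [IsManifold (𝓡 n) ∞ M]
  [IsContinuousRiemannianBundle (EuclideanSpace ℝ (Fin n)) (fun x : M ↦ TangentSpace (𝓡 n) x)]
  [IsRiemannianManifold (𝓡 n) M] [ProperSpace M]
  {q A S : ℝ} {σ : M → ℝ}

/-- The number of ends with respect to a compact set is bounded in terms of `n`, `ε(n, A)`, `α` and
`V_∞`: a common scale `R` is chosen beyond which all the ends of the family are visible. -/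
lemma SobolevInequality.card_ends_le (hSob : SobolevInequality n q A σ)
    (hS : ∀ t, |deriv Real.smoothTransition t| ≤ S) (hS1 : 1 ≤ 20 * S)
    (hq : 1 ≤ q) (hqn : q ≤ (n : ℝ) - 1) (hA : 0 < A)
    (hσ : Continuous σ) (hσ0 : ∀ x, 0 ≤ σ x) {ε : ℝ} (hε : 0 < ε) (hε1 : ε ≤ 1)
    (hεA : A * ((20 * S) ^ (n : ℝ) + 1) * 2 ^ (n : ℝ) * ε ^ (1 / (n : ℝ)) ≤ 1)
    (hεV : ENNReal.ofReal (ε * 4 ^ n) < volume (Metric.ball (0 : EuclideanSpace ℝ (Fin n)) 1))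
    {p : M} {α Vinf : ℝ≥0} (hα : asymptoticPotential n p q σ = α)
    (hV : asymptoticVolumeRatio n p = Vinf) {Ω : Set M} (hΩ : IsCompact Ω) (F : Finset (Set M))
    (hF : ∀ E ∈ F, E ∈ endsWithRespectTo Ω) :
    (F.card : ℝ) ≤ (α + 2) * (Vinf + 1) * (5 * 6 ^ n) / ε := by
  have : Nonempty M := ⟨p⟩
  have hex : ∀ E ∈ F, ∃ x, x ∈ E := fun E hE ↦ by
    obtain ⟨⟨x, hx, rfl⟩, -⟩ := hF E hE
    exact ⟨x, mem_connectedComponentIn hx⟩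
  choose! x hx using hex
  obtain ⟨ρ, hρ⟩ := (Metric.isBounded_iff_subset_closedBall p).1 hΩ.isBounded
  have e1 : ∀ᶠ R : ℝ in atTop, ∀ E ∈ F, dist p (x E) ≤ R :=
    (Finset.eventually_all F).2 fun E _ ↦ eventually_ge_atTop _
  have e2 := (tendsto_id.const_mul_atTop (show (0 : ℝ) < 3 by norm_num)).eventually
    (eventually_ballVolume_add_potential_le hα hV)
  obtain ⟨R, ⟨⟨hR1, hR2⟩, hR3⟩, hR0⟩ :=
    (((e1.and e2).and (eventually_ge_atTop (2 * ρ))).and (eventually_gt_atTop 0)).exists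
  have h1 := hSob.card_mul_le hS hS1 hq hqn hA hσ hσ0 hε hε1 hεA hεV hΩ.isClosed F hF hR0
    (fun E hE ↦ ⟨x E, hx E hE, hR1 E hE⟩)
    (hρ.trans (Metric.closedBall_subset_closedBall (by linarith)))
  have h2 := h1.trans hR2
  rw [← ENNReal.ofReal_natCast, ← ENNReal.ofReal_mul (by positivity),
    ENNReal.ofReal_le_ofReal_iff (by simp only [id]; positivity)] at h2
  rw [le_div_iff₀ hε]
  have hRn : 0 < (R / 2) ^ n := by positivity
  have e3 : (3 * R) ^ n = 6 ^ n * (R / 2) ^ n := by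
    rw [← mul_pow]; congr 1; ring
  simp only [id] at h2
  rw [e3] at h2
  refine le_of_mul_le_mul_right ?_ hRn
  linarith

end Ends

end Riem

theorem mainTheorem1 :
    ∃ Γ : (n : ℕ) → (A : ℝ) → (α : ℝ≥0) → (Vinf : ℝ≥0) → ℕ,
      ∀ (n : ℕ) (M : Type*) [MetricSpace M] [CompleteSpace M]
        [ChartedSpace (EuclideanSpace ℝ (Fin n)) M] [IsManifold (𝓡 n) ∞ M]
        [RiemannianBundle (fun x : M ↦ TangentSpace (𝓡 n) x)]
        [IsContMDiffRiemannianBundle (𝓡 n) ∞ (EuclideanSpace ℝ (Fin n))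
          (fun x : M ↦ TangentSpace (𝓡 n) x)]
        [IsRiemannianManifold (𝓡 n) M] [MeasurableSpace M] [BorelSpace M]
        (q A : ℝ) (σ : M → ℝ) (p : M) (α Vinf : ℝ≥0),
        1 ≤ q → q ≤ (n : ℝ) - 1 → 0 < A → Continuous σ → (∀ x, 0 ≤ σ x) →
        Riem.SobolevInequality n q A σ →
        Riem.asymptoticPotential n p q σ = (α : ℝ≥0∞) →
        Riem.asymptoticVolumeRatio n p = (Vinf : ℝ≥0∞) →
        Riem.numberOfEnds M ≤ (Γ n A α Vinf : ℕ∞) := by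
  obtain ⟨S₀, hS₀⟩ := Riem.exists_abs_deriv_smoothTransition_le
  set S := max S₀ 1
  have hS : ∀ t, |deriv Real.smoothTransition t| ≤ S := fun t ↦ (hS₀ t).trans (le_max_left _ _)
  have hS1 : 1 ≤ 20 * S := by linarith [le_max_right S₀ 1]
  choose! ε hε0 hε1 hεA hεV using fun (n : ℕ) (A : ℝ) (hn : 0 < n) ↦
    Riem.exists_volume_threshold hn A S
  refine ⟨fun n A α Vinf ↦ ⌈((α : ℝ) + 2) * (Vinf + 1) * (5 * 6 ^ n) / ε n A⌉₊, ?_⟩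
  intro n M _ _ _ _ _ _ _ _ _ q A σ p α Vinf hq hqn hA hσ hσ0 hSob hα hV
  have hn : 0 < n := by
    have : (0 : ℝ) < n := by linarith
    exact_mod_cast this
  have := Riem.properSpace_of_complete n M
  have := Riem.isContinuousRiemannianBundle n M
  refine iSup₂_le fun Ω hΩ ↦ ?_
  by_contra hlt
  rw [not_le] at hlt
  obtain ⟨t, htE, htc⟩ := Set.exists_subset_encard_eq (Order.add_one_le_of_lt hlt)
  have htf : t.Finite := Set.finite_of_encard_eq_coe (k := _ + 1) (by exact_mod_cast htc)
  have h1 := hSob.card_ends_le hS hS1 hq hqn hA hσ hσ0 (hε0 n A hn) (hε1 n A hn) (hεA n A hn)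
    (hεV n A hn) hα hV hΩ htf.toFinset fun E hE ↦ htE (htf.mem_toFinset.1 hE)
  rw [htf.encard_eq_coe_toFinset_card] at htc
  have h2 : htf.toFinset.card = ⌈((α : ℝ) + 2) * (Vinf + 1) * (5 * 6 ^ n) / ε n A⌉₊ + 1 := by
    exact_mod_cast htc
  have h3 := Nat.le_ceil (((α : ℝ) + 2) * (Vinf + 1) * (5 * 6 ^ n) / ε n A)
  have h4 : htf.toFinset.card ≤ ⌈((α : ℝ) + 2) * (Vinf + 1) * (5 * 6 ^ n) / ε n A⌉₊ := by
    exact_mod_cast h1.trans h3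
  omega
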